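/- **Setting.** Let $\mathcal X$ be a compact topological space and $\mu$ a Radon measure on $\mathcal X$ whose support is $\mathcal X$. Let $I\subset(0,\infty)$ be a nonempty open interval, $\tau\in C^\infty(I)$ with $\tau'>0$ on $I$, and $h\in C^\infty(\tau(I))$ with $h''>0$ on $\tau(I)$. Put $\mathcal P_I(\mu)=\{p\in L^1(\mu)\mid p\in I\ \mu\text{-a.e.},\ \|p\|_{L^1(\mu)}=1\}$ and, for $s,t\in I$, $$d_{h,\tau}(t,s)=h(\tau(t))-h(\tau(s))-(\tau(t)-\tau(s))\,h'(\tau(s)),\qquad s^\star_{h,\tau}(t)=-\tau(t)h'(\tau(t))+h(\tau(t)).$$ The $(h,\tau)$-divergence is $D_{h,\tau}(p,q)=\int_{\mathcal X}d_{h,\tau}(p(x),q(x))\,d\mu(x)\in[0,\infty]$, and $\mathbb I_\varphi(p)=\int_{\mathcal X}\varphi(p(x))\,d\mu(x)$ for $\varphi\in C^\infty(I)$. A *statistical model* in $\mathcal P_I(\mu)$ is a connected, Hausdorff, second countable smooth manifold $\mathcal M$ without boundary, of dimension $n$, whose points are elements of $\mathcal P_I(\mu)$ (given by pointwise defined representatives),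 such that for some $\mu$-null set $\mathcal N$ and with $e_x(p)=p(x)$: the topology of $\mathcal M$ is the one induced by the functions $e_x$, $x\notin\mathcal N$; these functions are smooth; for each $p$ the derivatives of $e_x$ of any order at $p$ are Borel functions of $x\in\mathcal X\setminus\mathcal N$; for a vector field $V$ and a point $p$, $V_p(e_x)=0$ for all $x\notin\mathcal N$ if and only if $V_p=0$; and for vector fields $V,W$ and every $p$ the functions $x\mapsto V_p(e_x)$ and $x\mapsto V_p(We_x)$ are $\mu$-integrable with integral $0$. An *$(h,\tau)$-exponential coordinate representation* $(U,\theta,T,c,\psi)$ on $\mathcal M$ consists of a coordinate system $(U,\theta)$ of $\mathcal M$, continuous maps $T\colon\mathcal X\to\mathbb R^n$ and $c\colon\mathcal X\to\mathbb R$, and a smooth function $\psi$ on $U$ such that, for all $p\in U$ and all $x\in\mathcal X$, $p(x)\in I$ and $$h'(\tau(p(x)))=\langle\theta(p),T(x)\rangle-c(x)-\psi(p).$$ $\mathcal M$ is an *$(h,\tau)$-exponential family* if it is a statistical model and each of its points has such a representation around it. If $U=\mathcal M$, then $\psi$ is called a *global $(h,\tau)$-exponential normalization*. A *Hessian structure*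 on $\mathcal M$ is a pair $(g,\nabla)$ of a smooth Riemannian metric and a smooth connection with vanishing torsion and curvature such that, around each point, $g=\nabla d\Psi$ for some smooth function $\Psi$, where $(\nabla d\Psi)(V,W)=V(W\Psi)-(\nabla_VW)\Psi$; a *global potential* is a smooth $\Psi$ on $\mathcal M$ with $g=\nabla d\Psi$ on $\mathcal M$. **Theorem 1.1.** Let $\mathcal M$ be an $(h,\tau)$-exponential family in $\mathcal P_I(\mu)$ on which $\mathbb I_\tau$ is constant. Then $D_{h,\tau}$ is finite and smooth on $\mathcal M\times\mathcal M$, and there are a Riemannian metric $g=g^{h,\tau}$ and a connection $\nabla=\nabla^{h,\tau}$ on $\mathcal M$ induced by $D_{h,\tau}$, that is, with $\widetilde V=(V,0)$ and $\widehat V=(0,V)$, $$g_p(V,W)=-\widetilde V_{(p,p)}(\widehat WD_{h,\tau}),\qquad g_p(\nabla_ZV,W)=-\widehat Z_{(p,p)}(\widehat V\widetilde WD_{h,\tau})$$ for all smooth vector fields $V,W,Z$ and all $p\in\mathcal M$; the same formulas hold with the derivatives taken under the integral sign, the resulting integrands being $\mu$-integrable. The pair $(g^{h,\tau},\nabla^{h,\tau})$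 is a Hessian structure on $\mathcal M$. A global $(h,\tau)$-exponential normalization exists, and for every global $(h,\tau)$-exponential normalization $\psi$ the function $$-\mathbb I_{s^\star_{h,\tau}}+\psi\,\mathbb I_\tau$$ is a global potential of $(g^{h,\tau},\nabla^{h,\tau})$; the integrals defining $\mathbb I_{s^\star_{h,\tau}}$ and $\mathbb I_\tau$ converge on $\mathcal M$. -/

import Mathlib

open MeasureTheory
open scoped Manifold ContDiff

noncomputable section

namespace DeformedExp

/-! ### Calculus on an `n`-dimensional smooth manifold -/

/-- `ℝⁿ` with its standard inner product. -/
abbrev Coord (n : ℕ) : Type := EuclideanSpace ℝ (Fin n)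

/-- Smooth vector fields `𝔛(M)`. -/
abbrev VField (n : ℕ) (M : Type*) [TopologicalSpace M] [ChartedSpace (Coord n) M]
    [IsManifold (𝓡 n) ∞ M] : Type _ :=
  ContMDiffSection (𝓡 n) (Coord n) ∞ (fun p : M => TangentSpace (𝓡 n) p)

/-- Smooth Riemannian metrics. -/
abbrev Metric (n : ℕ) (M : Type*) [TopologicalSpace M] [ChartedSpace (Coord n) M]
    [IsManifold (𝓡 n) ∞ M] : Type _ :=
  Bundle.ContMDiffRiemannianMetric (𝓡 n) ∞ (Coord n) (fun p : M => TangentSpace (𝓡 n) p)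

/-- Affine connections; `∇ W p (V p)` is the value of `∇_V W` at `p`.
The smoothness of `∇` is the separate predicate `CovariantDerivative.ContMDiffCovariantDerivative ∇ ∞`. -/
abbrev Connection (n : ℕ) (M : Type*) [TopologicalSpace M] [ChartedSpace (Coord n) M]
    [IsManifold (𝓡 n) ∞ M] : Type _ :=
  CovariantDerivative (𝓡 n) (Coord n) (fun p : M => TangentSpace (𝓡 n) p)

section Manifold

variable {n : ℕ} {M : Type*} [TopologicalSpace M] [ChartedSpace (Coord n) M]
  [IsManifold (𝓡 n) ∞ M]

/-- The derivative `V f` of a function along a vector field. -/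
def dirDeriv (V : VField n M) (f : M → ℝ) (p : M) : ℝ :=
  mvfderiv (𝓡 n) f p (V p)

/-- The derivative of `F : M × M → ℝ` along the vector field `(V, 0)`. -/
def fstDeriv (V : VField n M) (F : M → M → ℝ) (p q : M) : ℝ :=
  dirDeriv V (fun p' => F p' q) p

/-- The derivative of `F : M × M → ℝ` along the vector field `(0, V)`. -/
def sndDeriv (V : VField n M) (F : M → M → ℝ) (p q : M) : ℝ :=
  dirDeriv V (fun q' => F p q') q

/-- The iterated derivative `V₁ (V₂ (⋯ (Vₖ f)))`. -/
def iterDeriv (L : List (VField n M)) (f : M → ℝ) : M → ℝ :=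
  L.foldr (fun V u => dirDeriv V u) f

/-- The curvature `∇_V ∇_W Z - ∇_W ∇_V Z - ∇_[V,W] Z`. -/
def curvature (cov : Connection n M) (V W Z : VField n M) (p : M) : TangentSpace (𝓡 n) p :=
  cov (fun q => cov Z q (W q)) p (V p) - cov (fun q => cov Z q (V q)) p (W p)
    - cov Z p (VectorField.mlieBracket (𝓡 n) V W p)

/-- A connection is flat if its torsion and its curvature vanish. -/
def IsFlat (cov : Connection n M) : Prop :=
  cov.torsion = 0 ∧
  ∀ (V W Z : VField n M) (p : M), curvature cov V W Z p = 0

/-- `(∇ dΨ)(V, W) = V (W Ψ) - (∇_V W) Ψ`. -/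
def covHessian (cov : Connection n M) (Ψ : M → ℝ) (V W : VField n M) (p : M) : ℝ :=
  dirDeriv V (dirDeriv W Ψ) p - mvfderiv (𝓡 n) Ψ p (cov W p (V p))

/-- `Ψ` is a potential of `(g, ∇)` on the open set `U`: it is smooth on `U` and `g = ∇ dΨ` there. -/
def IsPotentialOn (g : Metric n M) (cov : Connection n M) (U : Set M) (Ψ : M → ℝ) : Prop :=
  ContMDiffOn (𝓡 n) 𝓘(ℝ, ℝ) ∞ Ψ U ∧
  ∀ (V W : VField n M), ∀ p ∈ U, g.inner p (V p) (W p) = covHessian cov Ψ V W p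

/-- Hessian structures: `∇` is a flat smooth connection and `g` has local potentials. -/
def IsHessianStructure (g : Metric n M) (cov : Connection n M) : Prop :=
  CovariantDerivative.ContMDiffCovariantDerivative cov ∞ ∧ IsFlat cov ∧
  ∀ p : M, ∃ U : Set M, IsOpen U ∧ p ∈ U ∧ ∃ Ψ : M → ℝ, IsPotentialOn g cov U Ψ

/-- `(g, ∇)` is induced by the two-point function `D`:
`g(V, W) = -(V,0)(0,W) D` and `g(∇_Z V, W) = -(0,Z)(0,V)(W,0) D` on the diagonal. -/
def IsInducedBy (D : M → M → ℝ) (g : Metric n M) (cov : Connection n M) : Prop :=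
  (∀ (V W : VField n M) (p : M),
    g.inner p (V p) (W p) = -fstDeriv V (sndDeriv W D) p p) ∧
  ∀ (V W Z : VField n M) (p : M),
    g.inner p (cov V p (Z p)) (W p) = -sndDeriv Z (sndDeriv V (fstDeriv W D)) p p

/-- The same formulas with the differentiation carried out under the integral sign, for a
two-point function that is an integral `∫ d_x dμ(x)`; the integrability is part of the claim. -/
def IsInducedUnderIntegral {X : Type*} [MeasurableSpace X] (μ : Measure X)
    (d : X → M → M → ℝ) (g : Metric n M) (cov : Connection n M) : Prop :=
  (∀ (V W : VField n M) (p : M),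
    Integrable (fun x => fstDeriv V (sndDeriv W (d x)) p p) μ ∧
    g.inner p (V p) (W p) = -∫ x, fstDeriv V (sndDeriv W (d x)) p p ∂μ) ∧
  ∀ (V W Z : VField n M) (p : M),
    Integrable (fun x => sndDeriv Z (sndDeriv V (fstDeriv W (d x))) p p) μ ∧
    g.inner p (cov V p (Z p)) (W p)
      = -∫ x, sndDeriv Z (sndDeriv V (fstDeriv W (d x))) p p ∂μ

end Manifold

/-! ### The pair `(h, τ)` and its divergence -/

/-- The set `𝒢` of triples `(h, τ, I)`: `I ⊆ (0, ∞)` is an open interval, `τ` is smooth on `I`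
with `τ' > 0`, and `h` is smooth on `τ(I)` with `h'' > 0`. -/
structure IsGauge (h τ : ℝ → ℝ) (I : Set ℝ) : Prop where
  isOpen : IsOpen I
  ordConnected : I.OrdConnected
  nonempty : I.Nonempty
  subset_pos : I ⊆ Set.Ioi 0
  smooth_tau : ContDiffOn ℝ ∞ τ I
  deriv_tau_pos : ∀ t ∈ I, 0 < deriv τ t
  smooth_h : ContDiffOn ℝ ∞ h (τ '' I)
  deriv2_h_pos : ∀ r ∈ τ '' I, 0 < deriv (deriv h) r

/-- `d_{h,τ}(t, s) = h(τ(t)) - h(τ(s)) - (τ(t) - τ(s)) h'(τ(s))`. -/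
def dHT (h τ : ℝ → ℝ) (t s : ℝ) : ℝ :=
  h (τ t) - h (τ s) - (τ t - τ s) * deriv h (τ s)

/-- `s⋆_{h,τ} = -τ · (h' ∘ τ) + h ∘ τ`. -/
def sStar (h τ : ℝ → ℝ) (t : ℝ) : ℝ :=
  -(τ t * deriv h (τ t)) + h (τ t)

section Families

variable {X : Type*} [MeasurableSpace X] {M : Type*}

/-- `M`, with `ρ p : X → ℝ` the function belonging to the point `p`, is a subset of `𝒫_I(μ)`:
the points are `μ`-integrable functions with values in `I` almost everywhere and of `L¹`-norm one,
and points are equal when their functions are equal almost everywhere. -/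
structure IsDensityFamily (μ : Measure X) (I : Set ℝ) (ρ : M → X → ℝ) : Prop where
  integrable : ∀ p, Integrable (ρ p) μ
  mem_ae : ∀ p, ∀ᵐ x ∂μ, ρ p x ∈ I
  norm_eq_one : ∀ p, ∫ x, ‖ρ p x‖ ∂μ = 1
  injective : ∀ p q, ρ p =ᵐ[μ] ρ q → p = q

/-- The functional `𝕀_φ(p) = ∫ φ(p(x)) dμ(x)`. -/
def intFun (μ : Measure X) (ρ : M → X → ℝ) (φ : ℝ → ℝ) (p : M) : ℝ :=
  ∫ x, φ (ρ p x) ∂μ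

/-- The `(h,τ)`-divergence, with values in `[0, ∞]`. -/
def divergence (μ : Measure X) (h τ : ℝ → ℝ) (ρ : M → X → ℝ) (p q : M) : ENNReal :=
  ∫⁻ x, ENNReal.ofReal (dHT h τ (ρ p x) (ρ q x)) ∂μ

variable {n : ℕ} [TopologicalSpace M] [ChartedSpace (Coord n) M] [IsManifold (𝓡 n) ∞ M]

/-- The five conditions on a manifold of densities that make it a statistical model, for the
exceptional null set `N`. The evaluation function `e_x` is `fun p => ρ p x`. -/
structure IsStatisticalModelOff (n : ℕ) {M : Type*} [TopologicalSpace M]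
    [ChartedSpace (Coord n) M] [IsManifold (𝓡 n) ∞ M]
    (μ : Measure X) (ρ : M → X → ℝ) (N : Set X) : Prop where
  null : μ N = 0
  topology_eq : (inferInstance : TopologicalSpace M) =
    ⨅ x : (Nᶜ : Set X), TopologicalSpace.induced (fun p => ρ p x) inferInstance
  smooth_eval : ∀ x ∉ N, ContMDiff (𝓡 n) 𝓘(ℝ, ℝ) ∞ (fun p => ρ p x)
  measurable_deriv : ∀ (L : List (VField n M)) (p : M),
    Measurable (fun x : (Nᶜ : Set X) => iterDeriv L (fun q => ρ q x) p)
  deriv_eq_zero_iff : ∀ (V : VField n M) (p : M),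
    (∀ x ∉ N, dirDeriv V (fun q => ρ q x) p = 0) ↔ V p = 0
  integral_deriv : ∀ (V : VField n M) (p : M),
    Integrable (fun x => dirDeriv V (fun q => ρ q x) p) μ ∧
    ∫ x, dirDeriv V (fun q => ρ q x) p ∂μ = 0
  integral_deriv₂ : ∀ (V W : VField n M) (p : M),
    Integrable (fun x => dirDeriv V (dirDeriv W (fun q => ρ q x)) p) μ ∧
    ∫ x, dirDeriv V (dirDeriv W (fun q => ρ q x)) p ∂μ = 0

variable [TopologicalSpace X]

/-- `(U, θ, T, c, ψ)` with `U = θ.source` is an `(h,τ)`-exponential coordinate representation: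
`(U, θ)` is a coordinate system, `T` and `c` are continuous, `ψ` is smooth on `U`, and
`h'(τ(p(x))) = ⟨θ(p), T(x)⟩ - c(x) - ψ(p)` for all `p ∈ U` and all `x`. -/
structure IsExpCoordRep (h τ : ℝ → ℝ) (I : Set ℝ) (ρ : M → X → ℝ)
    (θ : OpenPartialHomeomorph M (Coord n)) (T : X → Coord n) (c : X → ℝ) (ψ : M → ℝ) :
    Prop where
  chart : θ ∈ IsManifold.maximalAtlas (𝓡 n) ∞ M
  continuous_T : Continuous T
  continuous_c : Continuous c
  smooth_psi : ContMDiffOn (𝓡 n) 𝓘(ℝ, ℝ) ∞ ψ θ.source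
  mem : ∀ p ∈ θ.source, ∀ x, ρ p x ∈ I
  eq : ∀ p ∈ θ.source, ∀ x,
    deriv h (τ (ρ p x)) = inner ℝ (θ p) (T x) - c x - ψ p

/-- `ψ` is a global `(h,τ)`-exponential normalization of the `n`-dimensional manifold `M`: it
belongs to an `(h,τ)`-exponential coordinate representation defined on the whole of `M`. -/
def IsGlobalNormalization (n : ℕ) {M : Type*} [TopologicalSpace M]
    [ChartedSpace (Coord n) M] [IsManifold (𝓡 n) ∞ M]
    (h τ : ℝ → ℝ) (I : Set ℝ) (ρ : M → X → ℝ) (ψ : M → ℝ) : Prop :=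
  ∃ (θ : OpenPartialHomeomorph M (Coord n)) (T : X → Coord n) (c : X → ℝ),
    θ.source = Set.univ ∧ IsExpCoordRep h τ I ρ θ T c ψ

/-- `(h,τ)`-exponential families of dimension `n` in `𝒫_I(μ)`. -/
structure IsExpFamily (n : ℕ) {M : Type*} [TopologicalSpace M]
    [ChartedSpace (Coord n) M] [IsManifold (𝓡 n) ∞ M]
    (μ : Measure X) (h τ : ℝ → ℝ) (I : Set ℝ) (ρ : M → X → ℝ) : Prop where
  density : IsDensityFamily μ I ρ
  model : ∃ N : Set X, IsStatisticalModelOff n μ ρ N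
  rep : ∀ p : M, ∃ (θ : OpenPartialHomeomorph M (Coord n)) (T : X → Coord n) (c : X → ℝ)
    (ψ : M → ℝ), p ∈ θ.source ∧ IsExpCoordRep h τ I ρ θ T c ψ

end Families

end DeformedExp

end

open MeasureTheory
open scoped Manifold ContDiff

noncomputable section

namespace DeformedExp

open Set Filter Topology

/-! ### Differentiation of parametric integrals over a compact space -/

section ParametricIntegral

/-! Rigidity. In an exponential representation the components of `T` and the constant `1` are
linearly independent functions (`IsExpCoordRep.eq_zero_of_inner_const`): if `⟨b, T⟩` were constant,
the tangent vector with coordinates `b` would differentiate every `e_x` to a number of one and the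
same sign, while the integral of these numbers is zero. Hence two overlapping representations differ
by an invertible affine change of coordinates. Connectedness spreads one pair `(T, c)` over all of
`M`, and representations with the same `(T, c)` agree where they meet. They glue to a map `θ : M →
ℝⁿ`, which is injective because two densities with equal `θ` are pointwise comparable and both have
integral one (`IsExpFamily.exists_global_rep`).

Divergence. Let `S` be the inverse of `h'` and `u = ⟨θ, T⟩ - c - ψ`, so that `τ(p(x)) = S(u)`.
Expanding `h'(τ(q(x)))` turns the integrand of the divergence into `A(p) + B(q) - ⟨θ(q), η(p)⟩ +
s(p) ψ(q)`, with `η = τ(p(x)) T(x)` and `s = τ(p(x))`. Compactness of `X` makes everything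
continuous in `x`, so integration preserves this form and commutes with differentiation
(`IsExpCoordRep.divergence_eq`). After integration `s` is `𝕀_τ`, a constant, so the last term
disappears from every derivative that involves `p`. The pairing is linear in `θ(q)`; hence the
induced metric is the Jacobian `Dη` and the induced connection is the flat one for which `θ` is
affine.

Metric and potential. Since `d𝕀_τ = 0`, one has `⟨w, Dη v⟩ = ∫ S'(u) ℓ(v) ℓ(w) dμ` with `ℓ(v) = ⟨v,
T⟩ - dψ(v)`. This is symmetric, and it is positive definite by rigidity and the full support of `μ`.
With `h*` the Legendre transform of `h`, the proposed potential is `∫ h*(u) dμ + ψ 𝕀_τ`. As `(h*)' =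
S`, its differential is `v ↦ ⟨v, η⟩` (`IsExpCoordRep.hasFDerivAt_potential`), so its Hessian is
`Dη`. Any other global normalization yields such a pair as well, and the two pairs coincide because
the divergence determines them (`IsInducedBy.isPotentialOn`). -/

theorem continuous_comp_prodMk {X Y E F : Type*} [TopologicalSpace X] [TopologicalSpace Y]
    [TopologicalSpace E] [TopologicalSpace F]
    {Φ : Y × E → F} {Ω : Set (Y × E)} (h : ContinuousOn Φ Ω) {y : X → Y}
    (hy : Continuous y) {z : E} (hz : ∀ x, (y x, z) ∈ Ω) : Continuous (fun x => Φ (y x, z)) :=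
  h.comp_continuous (by fun_prop) hz


variable {X : Type*} [TopologicalSpace X] [CompactSpace X] [MeasurableSpace X] [BorelSpace X]
  {μ : Measure X} [IsFiniteMeasureOnCompacts μ]

theorem integrable_of_continuous_of_compactSpace {F : Type*} [NormedAddCommGroup F]
    {f : X → F} (hf : Continuous f) : Integrable f μ :=
  hf.integrable_of_hasCompactSupport (HasCompactSupport.of_compactSpace f)

variable {Y E : Type} [NormedAddCommGroup Y] [NormedSpace ℝ Y] [NormedAddCommGroup E]
  [NormedSpace ℝ E]

/-- The partial derivative in the second variable. -/
def sndFDeriv {F : Type} [NormedAddCommGroup F] [NormedSpace ℝ F] (Φ : Y × E → F) (w : Y × E) :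
    E →L[ℝ] F :=
  (fderiv ℝ Φ w).comp (ContinuousLinearMap.inr ℝ Y E)

theorem hasFDerivAt_sndFDeriv {F : Type} [NormedAddCommGroup F] [NormedSpace ℝ F] {Φ : Y × E → F}
    {y : Y} {z : E} (h : DifferentiableAt ℝ Φ (y, z)) :
    HasFDerivAt (fun z => Φ (y, z)) (sndFDeriv Φ (y, z)) z :=
  h.hasFDerivAt.comp z (hasFDerivAt_prodMk_right y z)

theorem _root_.ContDiffOn.sndFDeriv {F : Type} [NormedAddCommGroup F] [NormedSpace ℝ F]
    {Φ : Y × E → F} {Ω : Set (Y × E)} (hΩ : IsOpen Ω) (h : ContDiffOn ℝ ∞ Φ Ω) :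
    ContDiffOn ℝ ∞ (sndFDeriv Φ) Ω :=
  (h.fderiv_of_isOpen hΩ (by simp)).clm_comp contDiffOn_const

/-- Compactness of `X` supplies the dominating function: the partial derivative is bounded along the
image of `X` at `z`, hence uniformly for nearby parameters, and `μ` is finite. -/
theorem hasFDerivAt_integral_comp_prodMk {F : Type} [NormedAddCommGroup F] [NormedSpace ℝ F]
    {Φ : Y × E → F} {Ω : Set (Y × E)} (hΩ : IsOpen Ω) (h : ContDiffOn ℝ ∞ Φ Ω) {y : X → Y}
    (hy : Continuous y) {z : E} (hz : ∀ x, (y x, z) ∈ Ω) :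
    HasFDerivAt (fun z => ∫ x, Φ (y x, z) ∂μ) (∫ x, sndFDeriv Φ (y x, z) ∂μ) z := by
  have : IsFiniteMeasure μ := ⟨isCompact_univ.measure_lt_top⟩
  have hd := h.sndFDeriv hΩ
  have hc := continuous_comp_prodMk hd.continuousOn hy hz
  obtain ⟨C, hC⟩ := (isCompact_range hc).isBounded.exists_norm_le
  -- A tube argument: both conditions are open in `(x, z')`, and compactness of `X` makes the
  -- neighbourhood of `z` independent of `x`.
  have key : ∀ᶠ z' in 𝓝 z, ∀ x ∈ (univ : Set X),
      (y x, z') ∈ Ω ∧ ‖sndFDeriv Φ (y x, z')‖ ≤ C + 1 := by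
    refine isCompact_univ.eventually_forall_of_forall_eventually fun x _ => ?_
    have h1 : Tendsto (fun w : E × X => (y w.2, w.1)) (𝓝 (z, x)) (𝓝 (y x, z)) :=
      Continuous.tendsto (by fun_prop : Continuous fun w : E × X => (y w.2, w.1)) (z, x)
    have h2 := (hd.continuousOn.continuousAt (hΩ.mem_nhds (hz x))).norm
    have h3 : ‖sndFDeriv Φ (y x, z)‖ < C + 1 := by
      have := hC _ (mem_range_self x); linarith
    exact (h1.eventually (hΩ.mem_nhds (hz x))).and
      ((h1.eventually (h2.eventually_lt_const h3)).mono fun _ => le_of_lt)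
  simp only [mem_univ, true_implies] at key
  refine hasFDerivAt_integral_of_dominated_of_fderiv_le (𝕜 := ℝ) (F := fun z x => Φ (y x, z))
    (F' := fun z x => sndFDeriv Φ (y x, z)) (bound := fun _ => C + 1) key ?_ ?_ ?_ ?_ ?_ ?_
  · filter_upwards [key] with z' hz'
    exact (integrable_of_continuous_of_compactSpace
      (continuous_comp_prodMk h.continuousOn hy fun x => (hz' x).1)).aestronglyMeasurable
  · exact integrable_of_continuous_of_compactSpace (continuous_comp_prodMk h.continuousOn hy hz)
  · exact (integrable_of_continuous_of_compactSpace hc).aestronglyMeasurable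
  · exact ae_of_all _ fun x z' hz' => (hz' x).2
  · exact integrable_const _
  · refine ae_of_all _ fun x z' hz' => hasFDerivAt_sndFDeriv ?_
    exact (h.contDiffAt (hΩ.mem_nhds (hz' x).1)).differentiableAt (by simp)

/-- The derivative is again an integral of the same kind, with values in `E →L[ℝ] F`. The induction
therefore varies the target, and fixing all spaces in `Type` keeps it in one universe. -/
theorem contDiffOn_integral_comp_prodMk {F : Type} [NormedAddCommGroup F] [NormedSpace ℝ F]
    {Φ : Y × E → F} {Ω : Set (Y × E)} (hΩ : IsOpen Ω) (h : ContDiffOn ℝ ∞ Φ Ω) {y : X → Y}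
    (hy : Continuous y) {O : Set E} (hO : IsOpen O) (hz : ∀ z ∈ O, ∀ x, (y x, z) ∈ Ω) :
    ContDiffOn ℝ ∞ (fun z => ∫ x, Φ (y x, z) ∂μ) O := by
  rw [contDiffOn_infty]
  intro k
  induction k generalizing F with
  | zero =>
    exact contDiffOn_zero.2 fun z hzO =>
      (hasFDerivAt_integral_comp_prodMk hΩ h hy (hz z hzO)).continuousAt.continuousWithinAt
  | succ k ih =>
    rw [Nat.cast_succ, contDiffOn_succ_iff_fderiv_of_isOpen hO]
    refine ⟨fun z hzO => (hasFDerivAt_integral_comp_prodMk hΩ h hy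
      (hz z hzO)).differentiableAt.differentiableWithinAt, by simp, ?_⟩
    exact (ih (h.sndFDeriv hΩ)).congr fun z hzO =>
      (hasFDerivAt_integral_comp_prodMk hΩ h hy (hz z hzO)).fderiv

end ParametricIntegral

/-! ### The gauge `(h, τ)`: smooth inverses and convexity -/

section Gauge

/-- A smooth function with positive derivative on an open interval has a smooth inverse. -/
theorem exists_smooth_inverse {f : ℝ → ℝ} {K : Set ℝ} (hK : IsOpen K) (hc : K.OrdConnected)
    (hf : ContDiffOn ℝ ∞ f K) (hpos : ∀ r ∈ K, 0 < deriv f r) :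
    StrictMonoOn f K ∧ IsOpen (f '' K) ∧ ∃ S : ℝ → ℝ, ContDiffOn ℝ ∞ S (f '' K) ∧
      ∀ r ∈ K, S (f r) = r ∧ HasDerivAt S (deriv f r)⁻¹ (f r) := by
  have hmono : StrictMonoOn f K :=
    strictMonoOn_of_deriv_pos hc.convex hf.continuousOn (by rwa [hK.interior_eq])
  have hcd : ∀ r ∈ K, ContDiffAt ℝ ∞ f r := fun r hr => hf.contDiffAt (hK.mem_nhds hr)
  have hd : ∀ r ∈ K, HasDerivAt f (deriv f r) r := fun r hr =>
    ((hcd r hr).differentiableAt (by simp)).hasDerivAt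
  -- The inverse function theorem, with sources cut down to `K`. It gives both openness of the image
  -- and smoothness of the global inverse, which agrees locally with `e.symm`.
  have hloc : ∀ r ∈ K, ∃ e : OpenPartialHomeomorph ℝ ℝ,
      (∀ x, e x = f x) ∧ r ∈ e.source ∧ e.source ⊆ K := by
    intro r hr
    refine ⟨((hcd r hr).toOpenPartialHomeomorph f
      (f' := ContinuousLinearEquiv.unitsEquivAut ℝ (Units.mk0 _ (hpos r hr).ne')) ?_
      (by simp)).restrOpen K hK, fun x => rfl, ⟨?_, hr⟩, fun x hx => hx.2⟩
    · convert! (hd r hr).hasFDerivAt using 1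
    · exact ContDiffAt.mem_toOpenPartialHomeomorph_source _ _ _
  have hopen : IsOpen (f '' K) := by
    rw [isOpen_iff_mem_nhds]
    rintro _ ⟨r, hr, rfl⟩
    obtain ⟨e, he, hre, heK⟩ := hloc r hr
    refine mem_of_superset (e.open_target.mem_nhds (he r ▸ e.map_source hre)) fun y hy => ?_
    exact ⟨e.symm y, heK (e.map_target hy), by rw [← he, e.right_inv hy]⟩
  have hinv : ∀ r ∈ K, Function.invFunOn f K (f r) = r := fun r hr =>
    hmono.injOn.leftInvOn_invFunOn hr
  have hsmooth : ∀ r ∈ K, ContDiffAt ℝ ∞ (Function.invFunOn f K) (f r) := by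
    intro r hr
    obtain ⟨e, he, hre, heK⟩ := hloc r hr
    have hef : (e : ℝ → ℝ) = f := funext he
    have hr' : f r ∈ e.target := he r ▸ e.map_source hre
    have hsr : e.symm (f r) = r := by rw [← he, e.left_inv hre]
    have h1 : ContDiffAt ℝ ∞ e.symm (f r) := by
      refine e.contDiffAt_symm_deriv (hpos r hr).ne' hr' ?_ ?_
      · rw [hsr, hef]; exact hd r hr
      · rw [hsr, hef]; exact hcd r hr
    refine h1.congr_of_eventuallyEq ?_
    filter_upwards [e.open_target.mem_nhds hr'] with y hy
    conv_lhs => rw [← e.right_inv hy, he]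
    exact hinv _ (heK (e.map_target hy))
  refine ⟨hmono, hopen, Function.invFunOn f K, ?_, fun r hr => ⟨hinv r hr, ?_⟩⟩
  · rintro _ ⟨r, hr, rfl⟩
    exact (hsmooth r hr).contDiffWithinAt
  · refine HasDerivAt.of_local_left_inverse (hsmooth r hr).continuousAt
      (by rw [hinv r hr]; exact hd r hr) (hpos r hr).ne' ?_
    filter_upwards [hopen.mem_nhds (mem_image_of_mem f hr)]
    rintro _ ⟨s, hs, rfl⟩
    rw [hinv s hs]

variable {h τ : ℝ → ℝ} {I : Set ℝ}

theorem IsGauge.strictMonoOn_tau (hG : IsGauge h τ I) : StrictMonoOn τ I :=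
  (exists_smooth_inverse hG.isOpen hG.ordConnected hG.smooth_tau hG.deriv_tau_pos).1

theorem IsGauge.isOpen_image (hG : IsGauge h τ I) : IsOpen (τ '' I) :=
  (exists_smooth_inverse hG.isOpen hG.ordConnected hG.smooth_tau hG.deriv_tau_pos).2.1

theorem IsGauge.ordConnected_image (hG : IsGauge h τ I) : (τ '' I).OrdConnected :=
  (hG.ordConnected.isPreconnected.image τ hG.smooth_tau.continuousOn).ordConnected

theorem IsGauge.smooth_deriv (hG : IsGauge h τ I) : ContDiffOn ℝ ∞ (deriv h) (τ '' I) :=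
  hG.smooth_h.deriv_of_isOpen hG.isOpen_image (by simp)

theorem IsGauge.strictMonoOn_deriv (hG : IsGauge h τ I) : StrictMonoOn (deriv h) (τ '' I) :=
  (exists_smooth_inverse hG.isOpen_image hG.ordConnected_image hG.smooth_deriv
    hG.deriv2_h_pos).1

/-- The range of `h' ∘ τ`. -/
def dualRange (h τ : ℝ → ℝ) (I : Set ℝ) : Set ℝ := deriv h '' (τ '' I)

theorem IsGauge.isOpen_dualRange (hG : IsGauge h τ I) : IsOpen (dualRange h τ I) :=
  (exists_smooth_inverse hG.isOpen_image hG.ordConnected_image hG.smooth_deriv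
    hG.deriv2_h_pos).2.1

/-- A smooth inverse of `h'`. -/
def IsGauge.inverse (hG : IsGauge h τ I) : ℝ → ℝ :=
  (exists_smooth_inverse hG.isOpen_image hG.ordConnected_image hG.smooth_deriv
    hG.deriv2_h_pos).2.2.choose

theorem IsGauge.smooth_inverse (hG : IsGauge h τ I) :
    ContDiffOn ℝ ∞ hG.inverse (dualRange h τ I) :=
  (exists_smooth_inverse hG.isOpen_image hG.ordConnected_image hG.smooth_deriv
    hG.deriv2_h_pos).2.2.choose_spec.1

theorem IsGauge.inverse_deriv (hG : IsGauge h τ I) {r : ℝ} (hr : r ∈ τ '' I) :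
    hG.inverse (deriv h r) = r :=
  ((exists_smooth_inverse hG.isOpen_image hG.ordConnected_image hG.smooth_deriv
    hG.deriv2_h_pos).2.2.choose_spec.2 r hr).1

theorem IsGauge.inverse_mem (hG : IsGauge h τ I) {u : ℝ} (hu : u ∈ dualRange h τ I) :
    hG.inverse u ∈ τ '' I := by
  obtain ⟨r, hr, rfl⟩ := hu
  rwa [hG.inverse_deriv hr]

theorem IsGauge.deriv_inverse_eq (hG : IsGauge h τ I) {u : ℝ} (hu : u ∈ dualRange h τ I) :
    deriv h (hG.inverse u) = u := by
  obtain ⟨r, hr, rfl⟩ := hu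
  rw [hG.inverse_deriv hr]

theorem IsGauge.differentiableAt_inverse (hG : IsGauge h τ I) {u : ℝ}
    (hu : u ∈ dualRange h τ I) : DifferentiableAt ℝ hG.inverse u :=
  (hG.smooth_inverse.contDiffAt (hG.isOpen_dualRange.mem_nhds hu)).differentiableAt (by simp)

theorem IsGauge.deriv_inverse_pos (hG : IsGauge h τ I) {u : ℝ} (hu : u ∈ dualRange h τ I) :
    0 < deriv hG.inverse u := by
  obtain ⟨r, hr, rfl⟩ := hu
  have : HasDerivAt hG.inverse (deriv (deriv h) r)⁻¹ (deriv h r) :=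
    ((exists_smooth_inverse hG.isOpen_image hG.ordConnected_image hG.smooth_deriv
      hG.deriv2_h_pos).2.2.choose_spec.2 r hr).2
  rw [this.deriv]
  exact inv_pos.2 (hG.deriv2_h_pos r hr)

theorem IsGauge.hasDerivAt_h (hG : IsGauge h τ I) {r : ℝ} (hr : r ∈ τ '' I) :
    HasDerivAt h (deriv h r) r :=
  ((hG.smooth_h.contDiffAt (hG.isOpen_image.mem_nhds hr)).differentiableAt (by simp)).hasDerivAt

theorem IsGauge.hasDerivAt_tau (hG : IsGauge h τ I) {t : ℝ} (ht : t ∈ I) :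
    HasDerivAt τ (deriv τ t) t :=
  ((hG.smooth_tau.contDiffAt (hG.isOpen.mem_nhds ht)).differentiableAt (by simp)).hasDerivAt

/-- `h` is convex on `τ(I)`, and `dHT` is the height of its graph over the tangent line at `τ s`. -/
theorem IsGauge.dHT_nonneg (hG : IsGauge h τ I) {t s : ℝ} (ht : t ∈ I) (hs : s ∈ I) :
    0 ≤ dHT h τ t s := by
  have hc : ConvexOn ℝ (τ '' I) h := by
    refine MonotoneOn.convexOn_of_deriv hG.ordConnected_image.convex hG.smooth_h.continuousOn ?_ ?_
    · rw [hG.isOpen_image.interior_eq]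
      exact hG.smooth_h.differentiableOn (by simp)
    · rw [hG.isOpen_image.interior_eq]
      exact hG.strictMonoOn_deriv.monotoneOn
  have ht' := mem_image_of_mem τ ht
  have hs' := mem_image_of_mem τ hs
  have hd := hG.hasDerivAt_h hs'
  unfold dHT
  rcases lt_trichotomy (τ s) (τ t) with hlt | heq | hlt
  · have := hc.le_slope_of_hasDerivAt hs' ht' hlt hd
    rw [slope_def_field, le_div_iff₀ (by linarith)] at this
    linarith
  · rw [heq]; simp
  · have := hc.slope_le_of_hasDerivAt ht' hs' hlt hd
    rw [slope_def_field, div_le_iff₀ (by linarith)] at this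
    linarith

end Gauge

/-! ### Derivatives in charts and extension of tangent vectors -/

section ChartCalculus

variable {n : ℕ} {M : Type*} [TopologicalSpace M] [ChartedSpace (Coord n) M]

theorem chart_mdifferentiable {θ : OpenPartialHomeomorph M (Coord n)}
    (hθ : θ ∈ IsManifold.maximalAtlas (𝓡 n) ∞ M) :
    OpenPartialHomeomorph.MDifferentiable (𝓡 n) (𝓡 n) θ :=
  ⟨(contMDiffOn_of_mem_maximalAtlas hθ).mdifferentiableOn (by simp),
    (contMDiffOn_symm_of_mem_maximalAtlas hθ).mdifferentiableOn (by simp)⟩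

/-- The differential of a chart, as an isomorphism. -/
def chartEquiv {θ : OpenPartialHomeomorph M (Coord n)}
    (hθ : θ ∈ IsManifold.maximalAtlas (𝓡 n) ∞ M) {p : M} (hp : p ∈ θ.source) :
    TangentSpace (𝓡 n) p ≃L[ℝ] Coord n :=
  ((chart_mdifferentiable hθ).mfderiv hp).trans (NormedSpace.fromTangentSpace (θ p))

theorem chartEquiv_apply {θ : OpenPartialHomeomorph M (Coord n)}
    (hθ : θ ∈ IsManifold.maximalAtlas (𝓡 n) ∞ M) {p : M} (hp : p ∈ θ.source)
    (v : TangentSpace (𝓡 n) p) : chartEquiv hθ hp v = mvfderiv (𝓡 n) θ p v := rfl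

theorem mvfderiv_eq_of_eventuallyEq_comp_chart {G : Type*} [NormedAddCommGroup G]
    [NormedSpace ℝ G] {θ : OpenPartialHomeomorph M (Coord n)}
    (hθ : θ ∈ IsManifold.maximalAtlas (𝓡 n) ∞ M) {p : M} (hp : p ∈ θ.source) {f : M → G}
    {F : Coord n → G} (hf : f =ᶠ[𝓝 p] F ∘ θ) (hF : DifferentiableAt ℝ F (θ p)) :
    mvfderiv (𝓡 n) f p = (fderiv ℝ F (θ p)).comp (mvfderiv (𝓡 n) θ p) := by
  have h1 := hF.hasFDerivAt.hasMFDerivAt.comp p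
    ((chart_mdifferentiable hθ).mdifferentiableAt hp).hasMFDerivAt
  have h2 := (h1.congr_of_eventuallyEq hf).mfderiv
  unfold mvfderiv
  rw [h2]
  rfl

variable [IsManifold (𝓡 n) ∞ M]

/-- Every tangent vector is the value of a smooth vector field. -/
theorem exists_vField_apply_eq [T2Space M] [SecondCountableTopology M]
    {p : M} (v : TangentSpace (𝓡 n) p) :
    ∃ V : VField n M, V p = v := by
  have : LocallyCompactSpace M := Manifold.locallyCompact_of_finiteDimensional (𝓡 n)
  -- The prescribed value is a convex condition on each fibre, vacuous away from `p`, so local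
  -- solutions can be patched by a partition of unity.
  have hconv : ∀ q : M, Convex ℝ {w : TangentSpace (𝓡 n) q | ∀ h : p = q, w = h ▸ v} := by
    intro q w₁ h₁ w₂ h₂ a b ha hb hab h
    rw [h₁ h, h₂ h, ← add_smul, hab, one_smul]
  obtain ⟨s, hs⟩ := exists_contMDiffSection_forall_mem_convex_of_local (n := ⊤) (𝓡 n)
    (F_fiber := Coord n) (fun p : M => TangentSpace (𝓡 n) p) _ hconv (by
      intro q
      by_cases hq : q = p
      · subst hq
        obtain ⟨U, hU, hs⟩ := FiberBundle.exists_contMDiffOn_extend (k := ∞) (𝓡 n) (Coord n) v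
        refine ⟨U, hU, _, hs, ?_⟩
        rintro y hy rfl
        simp
      · refine ⟨{p}ᶜ, isOpen_compl_singleton.mem_nhds hq, fun _ => 0,
          (Bundle.contMDiff_zeroSection ℝ _).contMDiffOn, ?_⟩
        rintro y hy rfl
        exact absurd rfl hy)
  exact ⟨s, hs p rfl⟩

end ChartCalculus

/-! ### Comparable densities -/

section DensityFamily

variable {X M : Type*} [MeasurableSpace X] {μ : Measure X} {I : Set ℝ} {ρ : M → X → ℝ} {N : Set X}

theorem IsDensityFamily.measure_ne_zero (hd : IsDensityFamily μ I ρ) (p : M) : μ ≠ 0 := by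
  rintro rfl
  simpa using hd.norm_eq_one p

theorem ae_notMem_of_null (hN : μ N = 0) : ∀ᵐ x ∂μ, x ∉ N := measure_eq_zero_iff_ae_notMem.1 hN

/-- Comparable members of a density family coincide. -/
theorem IsDensityFamily.eq_of_le {p q : M} (hI : I ⊆ Ioi 0) (hd : IsDensityFamily μ I ρ)
    (hle : ∀ x, ρ p x ≤ ρ q x) : p = q := by
  have h1 : ∀ r, ∫ x, ρ r x ∂μ = 1 := fun r => by
    rw [← hd.norm_eq_one r]
    refine integral_congr_ae ?_
    filter_upwards [hd.mem_ae r] with x hx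
    exact (Real.norm_of_nonneg (le_of_lt (hI hx))).symm
  refine hd.injective p q ?_
  exact (integral_eq_iff_of_ae_le (hd.integrable p) (hd.integrable q) (ae_of_all _ hle)).1
    (by rw [h1, h1])

end DensityFamily

/-! ### Rigidity of exponential representations and their gluing -/

section Representations

variable {n : ℕ} {X : Type*} [TopologicalSpace X] [MeasurableSpace X] {μ : Measure X}
  {M : Type*} [TopologicalSpace M] [ChartedSpace (Coord n) M] [IsManifold (𝓡 n) ∞ M]
  {h τ : ℝ → ℝ} {I : Set ℝ} {ρ : M → X → ℝ} {N : Set X}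
  {θ θ' : OpenPartialHomeomorph M (Coord n)} {T T' : X → Coord n} {c c' : X → ℝ} {ψ ψ' : M → ℝ}

/-- The differential of `x ↦ h'(τ(p(x)))` in terms of that of the evaluation function. -/
theorem IsExpCoordRep.dirDeriv_eval (hG : IsGauge h τ I) (hN : IsStatisticalModelOff n μ ρ N)
    (R : IsExpCoordRep h τ I ρ θ T c ψ) {p : M} (hp : p ∈ θ.source) (V : VField n M) {x : X}
    (hx : x ∉ N) :
    deriv (deriv h) (τ (ρ p x)) * deriv τ (ρ p x) * dirDeriv V (fun q => ρ q x) p =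
      inner ℝ (mvfderiv (𝓡 n) θ p (V p)) (T x) - dirDeriv V ψ p := by
  have hI := R.mem p hp x
  have hK := mem_image_of_mem τ hI
  have hk : HasDerivAt (fun t => deriv h (τ t))
      (deriv (deriv h) (τ (ρ p x)) * deriv τ (ρ p x)) (ρ p x) :=
    HasDerivAt.comp (h₂ := deriv h) _ ((hG.smooth_deriv.contDiffAt
      (hG.isOpen_image.mem_nhds hK)).differentiableAt (by simp)).hasDerivAt (hG.hasDerivAt_tau hI)
  have he : MDifferentiableAt (𝓡 n) 𝓘(ℝ, ℝ) (fun q => ρ q x) p :=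
    (hN.smooth_eval x hx p).mdifferentiableAt (by simp)
  -- The function `q ↦ h'(τ(ρ q x))` is differentiated in two ways, by the chain rule here and
  -- through the representation in `h4`; uniqueness of the derivative equates the results.
  have h1 := hk.hasFDerivAt.hasMFDerivAt.comp p he.hasMFDerivAt
  have hψ : MDifferentiableAt (𝓡 n) 𝓘(ℝ, ℝ) ψ p :=
    (R.smooth_psi.contMDiffAt (θ.open_source.mem_nhds hp)).mdifferentiableAt (by simp)
  have hθ : MDifferentiableAt (𝓡 n) 𝓘(ℝ, Coord n) θ p :=
    (chart_mdifferentiable R.chart).mdifferentiableAt hp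
  have hl : HasFDerivAt (fun z : Coord n => inner ℝ z (T x) - c x)
      (innerSL ℝ (T x)) (θ p) := by
    have := ((innerSL ℝ (T x)).hasFDerivAt (x := θ p)).sub_const (c x)
    refine this.congr_of_eventuallyEq (Eventually.of_forall fun z => ?_)
    simp [real_inner_comm]
  have h2 := hl.hasMFDerivAt.comp p hθ.hasMFDerivAt
  have h3 := h2.sub hψ.hasMFDerivAt
  have h4 := h3.congr_of_eventuallyEq (f₁ := fun q => deriv h (τ (ρ q x))) (by
    filter_upwards [θ.open_source.mem_nhds hp] with q hq
    rw [R.eq q hq x]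
    rfl)
  have h5 := hasMFDerivAt_unique h1 h4
  have h6 := congrArg (fun L => L (V p)) h5
  have h7 : deriv (deriv h) (τ (ρ p x)) * deriv τ (ρ p x) * dirDeriv V (fun q => ρ q x) p =
      inner ℝ (T x) (mvfderiv (𝓡 n) θ p (V p)) - dirDeriv V ψ p := by
    rw [mul_comm]
    exact h6
  rw [h7, real_inner_comm]

/-- Rigidity: the tangent vector `V` with coordinates `b` satisfies `κ(x) · V e_x = k` off `N`, with
`κ > 0` and `k` independent of `x`. So `V e_x` has constant sign and integral zero, which forces `k
= 0`, then `V = 0` and `b = 0`. -/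
theorem IsExpCoordRep.eq_zero_of_inner_const [T2Space M] [SecondCountableTopology M]
    (hG : IsGauge h τ I) (hd : IsDensityFamily μ I ρ)
    (hN : IsStatisticalModelOff n μ ρ N) (R : IsExpCoordRep h τ I ρ θ T c ψ) {p : M}
    (hp : p ∈ θ.source) {a : ℝ} {b : Coord n} (H : ∀ x, inner ℝ b (T x) = a) : b = 0 := by
  obtain ⟨V, hV⟩ := exists_vField_apply_eq ((chartEquiv R.chart hp).symm b)
  have hVb : mvfderiv (𝓡 n) θ p (V p) = b := by
    rw [← chartEquiv_apply R.chart hp, hV, ContinuousLinearEquiv.apply_symm_apply]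
  set k := a - dirDeriv V ψ p
  have hκ : ∀ x, 0 < deriv (deriv h) (τ (ρ p x)) * deriv τ (ρ p x) := fun x =>
    mul_pos (hG.deriv2_h_pos _ (mem_image_of_mem τ (R.mem p hp x)))
      (hG.deriv_tau_pos _ (R.mem p hp x))
  have hk : ∀ x ∉ N, deriv (deriv h) (τ (ρ p x)) * deriv τ (ρ p x) *
      dirDeriv V (fun q => ρ q x) p = k := fun x hx => by
    rw [R.dirDeriv_eval hG hN hp V hx, hVb, H]
  -- The factor `s` treats both signs of `k` at once; it is taken to be `k` afterwards.
  have hsign : ∀ s : ℝ, 0 ≤ s * k → s * k = 0 := by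
    intro s hs
    have hnn : 0 ≤ᵐ[μ] fun x => s * dirDeriv V (fun q => ρ q x) p := by
      filter_upwards [ae_notMem_of_null hN.null] with x hx
      have := hκ x
      rw [← hk x hx] at hs
      by_contra hneg
      have : deriv (deriv h) (τ (ρ p x)) * deriv τ (ρ p x) *
        (s * dirDeriv V (fun q => ρ q x) p) < 0 := mul_neg_of_pos_of_neg this (not_le.1 hneg)
      linarith
    have h0 : ∫ x, s * dirDeriv V (fun q => ρ q x) p ∂μ = 0 := by
      rw [integral_const_mul, (hN.integral_deriv V p).2, mul_zero]
    rw [integral_eq_zero_iff_of_nonneg_ae hnn ((hN.integral_deriv V p).1.const_mul s)] at h0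
    have : (ae μ).NeBot := ae_neBot.2 (hd.measure_ne_zero p)
    obtain ⟨x, hx0, hx⟩ := (h0.and (ae_notMem_of_null hN.null)).exists
    have hx0 : s * dirDeriv V (fun q => ρ q x) p = 0 := hx0
    rw [← hk x hx]
    linear_combination (deriv (deriv h) (τ (ρ p x)) * deriv τ (ρ p x)) * hx0
  have hk0 : k = 0 := mul_self_eq_zero.1 (hsign k (mul_self_nonneg k))
  have hV0 : V p = 0 := (hN.deriv_eq_zero_iff V p).1 fun x hx => by
    have := hk x hx
    rw [hk0] at this
    exact (mul_eq_zero.1 this).resolve_left (hκ x).ne'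
  rw [← hVb, hV0, map_zero]

/-- A representation can be rewritten in terms of the functions `T`, `c` of an overlapping one. -/
theorem IsExpCoordRep.exists_same_statistics [T2Space M] [SecondCountableTopology M]
    (hG : IsGauge h τ I) (hd : IsDensityFamily μ I ρ)
    (hN : IsStatisticalModelOff n μ ρ N) (R : IsExpCoordRep h τ I ρ θ T c ψ)
    (R' : IsExpCoordRep h τ I ρ θ' T' c' ψ') {q : M} (hq : q ∈ θ.source) (hq' : q ∈ θ'.source) :
    ∃ (θ'' : OpenPartialHomeomorph M (Coord n)) (ψ'' : M → ℝ),
      θ''.source = θ'.source ∧ IsExpCoordRep h τ I ρ θ'' T c ψ'' := by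
  have heq : ∀ r ∈ θ.source, r ∈ θ'.source → ∀ x,
      inner ℝ (θ r) (T x) - c x - ψ r = inner ℝ (θ' r) (T' x) - c' x - ψ' r := fun r hr hr' x => by
    rw [← R.eq r hr x, R'.eq r hr' x]
  -- Subtracting the identities `heq` at `q` and at a point displaced from `q` by `ε e` in the chart
  -- `θ'` eliminates `c` and `c'`. Division by `ε` expresses the component of `T'` along `e`
  -- affinely in `T`.
  have hbasis : ∀ i : Fin n, ∃ (A : Coord n) (β : ℝ), ∀ x,
      inner ℝ (EuclideanSpace.basisFun (Fin n) ℝ i) (T' x) = inner ℝ A (T x) + β := by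
    intro i
    set e := EuclideanSpace.basisFun (Fin n) ℝ i
    have h1 : Tendsto (fun ε : ℝ => θ' q + ε • e) (𝓝[≠] 0) (𝓝 (θ' q)) := by
      have : Continuous (fun ε : ℝ => θ' q + ε • e) := by fun_prop
      simpa using (this.tendsto 0).mono_left nhdsWithin_le_nhds
    have h2 : ∀ᶠ y in 𝓝 (θ' q), y ∈ θ'.target ∧ θ'.symm y ∈ θ.source := by
      have h3 : ∀ᶠ y in 𝓝 (θ' q), y ∈ θ'.target := θ'.open_target.mem_nhds (θ'.map_source hq')
      refine h3.and ?_
      exact (θ'.continuousAt_symm (θ'.map_source hq')).eventually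
        (θ.open_source.mem_nhds (by rwa [θ'.left_inv hq']))
    obtain ⟨ε, ⟨hε1, hε2⟩, hε⟩ := ((h1.eventually h2).and eventually_mem_nhdsWithin).exists
    have hε : ε ≠ 0 := hε
    set r := θ'.symm (θ' q + ε • e)
    have hr := heq r hε2 (θ'.map_target hε1)
    rw [θ'.right_inv hε1] at hr
    refine ⟨ε⁻¹ • (θ r - θ q), ε⁻¹ * (ψ q - ψ r - (ψ' q - ψ' r)), fun x => ?_⟩
    have hr := hr x
    have hq0 := heq q hq hq' x
    rw [inner_add_left, inner_smul_left] at hr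
    rw [inner_smul_left, inner_sub_left]
    simp only [conj_trivial] at hr ⊢
    field_simp
    linarith
  choose A₀ β₀ h0 using hbasis
  let B := (EuclideanSpace.basisFun (Fin n) ℝ).toBasis
  let A : Coord n →ₗ[ℝ] Coord n := B.constr ℝ A₀
  let β : Coord n →ₗ[ℝ] ℝ := B.constr ℝ β₀
  have hA : ∀ e x, inner ℝ e (T' x) = inner ℝ (A e) (T x) + β e := by
    intro e x
    have : (innerₗ (Coord n) (T' x)) = (innerₗ (Coord n) (T x)) ∘ₗ A + β := by
      refine B.ext fun i => ?_
      have := h0 i x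
      simp only [LinearMap.add_apply, LinearMap.comp_apply, A, β, Module.Basis.constr_basis,
        innerₗ_apply_apply]
      rw [real_inner_comm, real_inner_comm (A₀ i)]
      simpa [B] using this
    have := LinearMap.congr_fun this e
    simp only [LinearMap.add_apply, LinearMap.comp_apply, innerₗ_apply_apply] at this
    rw [real_inner_comm, this, real_inner_comm]
  -- If `A e = 0`, then `⟨e, T'⟩` is constant, which rigidity of the primed representation excludes
  -- unless `e = 0`.
  have hinj : Function.Injective A := by
    rw [← LinearMap.ker_eq_bot, LinearMap.ker_eq_bot']
    intro e he
    refine R'.eq_zero_of_inner_const hG hd hN hq' (a := β e) fun x => ?_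
    rw [hA, he, inner_zero_left, zero_add]
  let Ae : Coord n ≃L[ℝ] Coord n := (LinearEquiv.ofInjectiveEndo A hinj).toContinuousLinearEquiv
  have hAe : ∀ e, Ae e = A e := fun e => rfl
  let k := θ q - A (θ' q)
  let βL : Coord n →L[ℝ] ℝ := β.toContinuousLinearMap
  have hsm : ContMDiffOn (𝓡 n) (𝓡 n) ∞ θ' θ'.source := contMDiffOn_of_mem_maximalAtlas R'.chart
  -- The translation `k` and the additive constant are chosen so that the new chart and
  -- normalization take the values `θ q` and `ψ q` at `q`; the identity at `q` then replaces `c'` by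
  -- `c`.
  refine ⟨θ'.transHomeomorph (Ae.toHomeomorph.trans (Homeomorph.addRight k)),
    fun r => ψ' r - βL (θ' r) + (β (θ' q) - ψ' q + ψ q), rfl, ?_, R.continuous_T,
    R.continuous_c, ?_, fun p hp => R'.mem p hp, fun p hp x => ?_⟩
  · refine OpenPartialHomeomorph.mem_maximalAtlas_of_contMDiffOn _ ?_ ?_
    · have : ContDiff ℝ ∞ (fun z => Ae z + k) := by fun_prop
      exact this.contMDiff.comp_contMDiffOn hsm
    · have h1 : ContDiff ℝ ∞ (fun z => Ae.symm (z + -k)) := by fun_prop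
      exact (contMDiffOn_symm_of_mem_maximalAtlas R'.chart).comp h1.contMDiff.contMDiffOn
        fun z hz => hz
  · have h1 : ContMDiffOn (𝓡 n) 𝓘(ℝ, ℝ) ∞ (fun r => βL (θ' r)) θ'.source :=
      βL.contDiff.contMDiff.comp_contMDiffOn hsm
    exact (R'.smooth_psi.sub h1).add contMDiffOn_const
  · have h1 := heq q hq hq' x
    rw [R'.eq p hp x]
    change _ = inner ℝ (A (θ' p) + (θ q - A (θ' q))) (T x) - c x - _
    have h2 : βL (θ' p) = β (θ' p) := rfl
    rw [inner_add_left, inner_sub_left, hA, h2]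
    rw [hA] at h1
    linarith

/-- The difference of the two equations says that `⟨θ q - θ' q, T⟩` is constant on `X`, so rigidity
applies. Evaluation at one sample point then compares the normalizations. -/
theorem IsExpCoordRep.eq_of_same_statistics [T2Space M] [SecondCountableTopology M]
    (hG : IsGauge h τ I) (hd : IsDensityFamily μ I ρ)
    (hN : IsStatisticalModelOff n μ ρ N) (R : IsExpCoordRep h τ I ρ θ T c ψ)
    (R' : IsExpCoordRep h τ I ρ θ' T c ψ') {q : M} (hq : q ∈ θ.source) (hq' : q ∈ θ'.source) :
    θ q = θ' q ∧ ψ q = ψ' q := by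
  have heq : ∀ x, inner ℝ (θ q - θ' q) (T x) = ψ q - ψ' q := fun x => by
    have h1 := R.eq q hq x
    rw [R'.eq q hq' x] at h1
    rw [inner_sub_left]
    linarith
  have h0 := R.eq_zero_of_inner_const hG hd hN hq heq
  have : Nonempty X := by
    by_contra hX
    have : IsEmpty X := not_nonempty_iff.1 hX
    exact hd.measure_ne_zero q (Measure.eq_zero_of_isEmpty μ)
  obtain ⟨x⟩ := this
  refine ⟨sub_eq_zero.1 h0, ?_⟩
  have := heq x
  rw [h0, inner_zero_left] at this
  linarith

/-- The points admitting a representation with the `T` and `c` of a base point form an open set. It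
is closed because a representation around a limit point can be rewritten by
`IsExpCoordRep.exists_same_statistics`. Connectedness concludes. -/
theorem IsExpFamily.exists_common_statistics [T2Space M] [SecondCountableTopology M]
    [ConnectedSpace M] (hG : IsGauge h τ I) (hM : IsExpFamily n μ h τ I ρ) :
    ∃ (T : X → Coord n) (c : X → ℝ), ∀ p : M,
      ∃ (θ : OpenPartialHomeomorph M (Coord n)) (ψ : M → ℝ),
        p ∈ θ.source ∧ IsExpCoordRep h τ I ρ θ T c ψ := by
  obtain ⟨N, hN⟩ := hM.model
  obtain ⟨p₀⟩ : Nonempty M := inferInstance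
  obtain ⟨θ₀, T, c, ψ₀, hp₀, R₀⟩ := hM.rep p₀
  refine ⟨T, c, ?_⟩
  let A : Set M := {p | ∃ (θ : OpenPartialHomeomorph M (Coord n)) (ψ : M → ℝ),
      p ∈ θ.source ∧ IsExpCoordRep h τ I ρ θ T c ψ}
  have hopen : IsOpen A := by
    rw [isOpen_iff_mem_nhds]
    rintro p ⟨θ, ψ, hp, R⟩
    exact mem_of_superset (θ.open_source.mem_nhds hp) fun q hq => ⟨θ, ψ, hq, R⟩
  have hclosed : IsClosed A := by
    refine isClosed_of_closure_subset fun p hp => ?_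
    obtain ⟨θ', T', c', ψ', hp', R'⟩ := hM.rep p
    obtain ⟨q, hq', θ, ψ, hq, R⟩ := mem_closure_iff.1 hp _ θ'.open_source hp'
    obtain ⟨θ'', ψ'', hs, R''⟩ := R.exists_same_statistics hG hM.density hN R' hq hq'
    exact ⟨θ'', ψ'', hs ▸ hp', R''⟩
  have := IsClopen.eq_univ ⟨hclosed, hopen⟩ ⟨p₀, θ₀, ψ₀, hp₀, R₀⟩
  exact fun p => (this ▸ mem_univ p : p ∈ A)

/-- An exponential family has a global exponential coordinate representation. -/
theorem IsExpFamily.exists_global_rep [T2Space M] [SecondCountableTopology M]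
    [ConnectedSpace M] (hG : IsGauge h τ I) (hM : IsExpFamily n μ h τ I ρ) :
    ∃ (θ : OpenPartialHomeomorph M (Coord n)) (T : X → Coord n) (c : X → ℝ) (ψ : M → ℝ),
      θ.source = univ ∧ IsExpCoordRep h τ I ρ θ T c ψ := by
  obtain ⟨N, hN⟩ := hM.model
  obtain ⟨T, c, H⟩ := hM.exists_common_statistics hG
  choose θ ψ hp R using H
  let Θ : M → Coord n := fun p => θ p p
  let Ψ : M → ℝ := fun p => ψ p p
  have hΘ : ∀ p, EqOn Θ (θ p) (θ p).source := fun p q hq =>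
    ((R q).eq_of_same_statistics hG hM.density hN (R p) (hp q) hq).1
  have hΨ : ∀ p, EqOn Ψ (ψ p) (θ p).source := fun p q hq =>
    ((R q).eq_of_same_statistics hG hM.density hN (R p) (hp q) hq).2
  have hev : ∀ p, Θ =ᶠ[𝓝 p] θ p := fun p =>
    (hΘ p).eventuallyEq_of_mem ((θ p).open_source.mem_nhds (hp p))
  have hsm : ContMDiff (𝓡 n) (𝓡 n) ∞ Θ := fun p =>
    ((contMDiffOn_of_mem_maximalAtlas (R p).chart).contMDiffAt
      ((θ p).open_source.mem_nhds (hp p))).congr_of_eventuallyEq (hev p)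
  have hrep : ∀ p x, deriv h (τ (ρ p x)) = inner ℝ (Θ p) (T x) - c x - Ψ p := fun p x =>
    (R p).eq p (hp p) x
  have hmem : ∀ p x, ρ p x ∈ I := fun p x => (R p).mem p (hp p) x
  -- With equal `Θ`, the larger normalization gives the pointwise smaller density, since `τ` and
  -- `h'` are increasing; comparable densities of integral one coincide.
  have hle : ∀ p q, Θ p = Θ q → Ψ q ≤ Ψ p → p = q := by
    intro p q hpq hψ
    refine hM.density.eq_of_le hG.subset_pos fun x => ?_
    rw [← hG.strictMonoOn_tau.le_iff_le (hmem p x) (hmem q x),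
      ← hG.strictMonoOn_deriv.le_iff_le (mem_image_of_mem τ (hmem p x))
        (mem_image_of_mem τ (hmem q x)), hrep, hrep, hpq]
    linarith
  have hinj : Function.Injective Θ := fun p q hpq =>
    (le_total (Ψ q) (Ψ p)).elim (hle p q hpq) fun h => (hle q p hpq.symm h).symm
  have hopen : IsOpenMap Θ := by
    refine IsOpenMap.of_nhds_le fun p => ?_
    rw [Filter.map_congr (hev p), (θ p).map_nhds_eq (hp p)]
  have hemb := Topology.IsOpenEmbedding.of_continuous_injective_isOpenMap hsm.continuous hinj hopen
  obtain ⟨p₀⟩ : Nonempty M := inferInstance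
  have : Nonempty M := ⟨p₀⟩
  refine ⟨hemb.toOpenPartialHomeomorph Θ, T, c, Ψ, rfl, ?_, (R p₀).continuous_T,
    (R p₀).continuous_c, fun p _ => ?_, fun p _ => hmem p, fun p _ => hrep p⟩
  · refine OpenPartialHomeomorph.mem_maximalAtlas_of_contMDiffOn _ hsm.contMDiffOn ?_
    intro y hy
    obtain ⟨p, rfl⟩ : y ∈ range Θ := by simpa using hy
    have hpt : Θ p ∈ (θ p).target := (θ p).map_source (hp p)
    refine (((contMDiffOn_symm_of_mem_maximalAtlas (R p).chart).contMDiffAt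
      ((θ p).open_target.mem_nhds hpt)).congr_of_eventuallyEq ?_).contMDiffWithinAt
    filter_upwards [(θ p).open_target.mem_nhds hpt] with z hz
    have hz' : Θ ((θ p).symm z) = z := by
      rw [hΘ p ((θ p).map_target hz), (θ p).right_inv hz]
    conv_lhs => rw [← hz']
    exact (hemb.toOpenPartialHomeomorph Θ).left_inv (mem_univ _)
  · exact (((R p).smooth_psi.contMDiffAt ((θ p).open_source.mem_nhds (hp p))).congr_of_eventuallyEq
      ((hΨ p).eventuallyEq_of_mem ((θ p).open_source.mem_nhds (hp p)))).contMDiffWithinAt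

end Representations

open Bundle

/-! ### Smoothness criteria for bundle maps and vector fields -/

section SmoothSections

variable {n : ℕ} {M : Type*} [TopologicalSpace M] [ChartedSpace (Coord n) M]

/-- A field of linear maps on a finite-rank bundle is smooth if it maps smooth sections to smooth
sections. -/
theorem contMDiffAt_hom_of_forall {F₁ F₂ : Type*} [NormedAddCommGroup F₁] [NormedSpace ℝ F₁]
    [FiniteDimensional ℝ F₁] [NormedAddCommGroup F₂] [NormedSpace ℝ F₂] {E₁ E₂ : M → Type*}
    [∀ x, AddCommGroup (E₁ x)] [∀ x, Module ℝ (E₁ x)] [TopologicalSpace (TotalSpace F₁ E₁)]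
    [∀ x, TopologicalSpace (E₁ x)] [FiberBundle F₁ E₁] [VectorBundle ℝ F₁ E₁]
    [∀ x, AddCommGroup (E₂ x)] [∀ x, Module ℝ (E₂ x)] [TopologicalSpace (TotalSpace F₂ E₂)]
    [∀ x, TopologicalSpace (E₂ x)] [FiberBundle F₂ E₂] [VectorBundle ℝ F₂ E₂]
    [∀ x, IsTopologicalAddGroup (E₁ x)] [∀ x, ContinuousSMul ℝ (E₁ x)]
    [∀ x, IsTopologicalAddGroup (E₂ x)] [∀ x, ContinuousSMul ℝ (E₂ x)]
    [ContMDiffVectorBundle ∞ F₁ E₁ (𝓡 n)] [ContMDiffVectorBundle ∞ F₂ E₂ (𝓡 n)]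
    {A : Π x, E₁ x →L[ℝ] E₂ x} {p : M}
    (H : ∀ s : Π x, E₁ x, ContMDiffAt (𝓡 n) ((𝓡 n).prod 𝓘(ℝ, F₁)) ∞
        (fun x => TotalSpace.mk' F₁ x (s x)) p →
      ContMDiffAt (𝓡 n) ((𝓡 n).prod 𝓘(ℝ, F₂)) ∞ (fun x => TotalSpace.mk' F₂ x (A x (s x))) p) :
    ContMDiffAt (𝓡 n) ((𝓡 n).prod 𝓘(ℝ, F₁ →L[ℝ] F₂)) ∞
      (fun x => TotalSpace.mk' (F₁ →L[ℝ] F₂) (E := fun x => E₁ x →L[ℝ] E₂ x) x (A x)) p := by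
  rw [contMDiffAt_hom_bundle]
  refine ⟨contMDiffAt_id, ?_⟩
  dsimp only
  set e₁ := trivializationAt F₁ E₁ p
  set e₂ := trivializationAt F₂ E₂ p
  have hp₁ : p ∈ e₁.baseSet := mem_baseSet_trivializationAt F₁ E₁ p
  have hp₂ : p ∈ e₂.baseSet := mem_baseSet_trivializationAt F₂ E₂ p
  -- The hypothesis is tested on sections that are constant in a trivialization; these give the
  -- columns of the coordinate matrix, which `h3` reassembles over a finite basis.
  have key : ∀ w : F₁, ContMDiffAt (𝓡 n) 𝓘(ℝ, F₂) ∞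
      (fun x => ContinuousLinearMap.inCoordinates F₁ E₁ F₂ E₂ p x p x (A x) w) p := by
    intro w
    have h1 : ContMDiffAt (𝓡 n) ((𝓡 n).prod 𝓘(ℝ, F₁)) ∞
        (fun x => TotalSpace.mk' F₁ x (e₁.symmL ℝ x w)) p := by
      rw [contMDiffAt_totalSpace]
      refine ⟨contMDiffAt_id, (contMDiffAt_const (c := w)).congr_of_eventuallyEq ?_⟩
      filter_upwards [e₁.open_baseSet.mem_nhds hp₁] with x hx
      rw [e₁.symmL_apply hx]
      exact congrArg Prod.snd (e₁.apply_mk_symm hx w)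
    have h2 := (contMDiffAt_totalSpace.1 (H _ h1)).2
    refine h2.congr_of_eventuallyEq ?_
    filter_upwards [e₁.open_baseSet.mem_nhds hp₁, e₂.open_baseSet.mem_nhds hp₂] with x hx₁ hx₂
    rw [ContinuousLinearMap.inCoordinates_eq hx₁ hx₂]
    simp [e₁, hx₁]
  have h3 : ContMDiffAt (𝓡 n) 𝓘(ℝ, F₁ →L[ℝ] F₂) ∞ (fun x => ∑ i,
      ContinuousLinearMap.smulRightL ℝ F₁ F₂
        (LinearMap.toContinuousLinearMap ((Module.finBasis ℝ F₁).coord i))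
        (ContinuousLinearMap.inCoordinates F₁ E₁ F₂ E₂ p x p x (A x)
          (Module.finBasis ℝ F₁ i))) p := by
    refine ContMDiffAt.sum fun i _ => ?_
    exact (ContinuousLinearMap.contDiff _).contMDiff.contMDiffAt.comp p (key _)
  refine h3.congr_of_eventuallyEq (Eventually.of_forall fun x => ?_)
  ext w
  conv_lhs => rw [← (Module.finBasis ℝ F₁).sum_repr w, map_sum]
  simp

variable [IsManifold (𝓡 n) ∞ M]

theorem contMDiffAt_mvfderiv_apply {G : Type*} [NormedAddCommGroup G] [NormedSpace ℝ G]
    {f : M → G} (hf : ContMDiff (𝓡 n) 𝓘(ℝ, G) ∞ f) {σ : Π p : M, TangentSpace (𝓡 n) p} {p : M}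
    (hσ : ContMDiffAt (𝓡 n) (𝓡 n).tangent ∞ (fun q => (⟨q, σ q⟩ : TangentBundle (𝓡 n) M)) p) :
    ContMDiffAt (𝓡 n) 𝓘(ℝ, G) ∞ (fun q => mvfderiv (𝓡 n) f q (σ q)) p :=
  ((contMDiff_snd_tangentBundle_modelSpace G 𝓘(ℝ, G)).comp
    (hf.contMDiff_tangentMap (m := ∞) (by simp))).contMDiffAt.comp p hσ

theorem mdifferentiableAt_mvfderiv_apply {G : Type*} [NormedAddCommGroup G] [NormedSpace ℝ G]
    {f : M → G} (hf : ContMDiff (𝓡 n) 𝓘(ℝ, G) ∞ f) {σ : Π p : M, TangentSpace (𝓡 n) p} {p : M}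
    (hσ : MDifferentiableAt (𝓡 n) (𝓡 n).tangent
      (fun q => (⟨q, σ q⟩ : TangentBundle (𝓡 n) M)) p) :
    MDifferentiableAt (𝓡 n) 𝓘(ℝ, G) (fun q => mvfderiv (𝓡 n) f q (σ q)) p :=
  (((contMDiff_snd_tangentBundle_modelSpace G 𝓘(ℝ, G)).comp
    (hf.contMDiff_tangentMap (m := ∞) (by simp))).contMDiffAt.mdifferentiableAt (by simp)).comp p hσ

variable {θ : OpenPartialHomeomorph M (Coord n)}

/-- The section is the pull-back under `θ` of the vector field `v ∘ θ.symm` on `ℝⁿ`, and pull-backs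
of smooth fields by a local diffeomorphism are smooth. -/
theorem contMDiffAt_chartEquiv_symm (hθ : θ ∈ IsManifold.maximalAtlas (𝓡 n) ∞ M)
    (hs : ∀ p, p ∈ θ.source) {v : M → Coord n} {p : M}
    (hv : ContMDiffAt (𝓡 n) 𝓘(ℝ, Coord n) ∞ v p) :
    ContMDiffAt (𝓡 n) (𝓡 n).tangent ∞
      (fun q => (⟨q, (chartEquiv hθ (hs q)).symm (v q)⟩ : TangentBundle (𝓡 n) M)) p := by
  let V : Π a : Coord n, TangentSpace (𝓡 n) a := fun a => v (θ.symm a)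
  have hV : ContMDiffAt (𝓡 n) (𝓡 n).tangent ∞ (fun a => (⟨a, V a⟩ : TangentBundle (𝓡 n) (Coord n)))
      (θ p) := by
    have h1 : ContMDiffAt (𝓡 n) 𝓘(ℝ, Coord n) ∞ (fun a => v (θ.symm a)) (θ p) := by
      refine ContMDiffAt.comp (g := v) (θ p) (by rwa [θ.left_inv (hs p)]) ?_
      exact contMDiffAt_symm_of_mem_maximalAtlas hθ (θ.map_source (hs p))
    rw [contMDiffAt_totalSpace]
    exact ⟨contMDiffAt_id, by simpa using h1⟩
  have h2 := ContMDiffAt.mpullback_vectorField_preimage (f := θ) (n := ∞) hV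
    (contMDiffAt_of_mem_maximalAtlas hθ (hs p))
    ⟨(chart_mdifferentiable hθ).mfderiv (hs p), rfl⟩ (by simp)
  refine h2.congr_of_eventuallyEq (Eventually.of_forall fun q => ?_)
  have : VectorField.mpullback (𝓡 n) (𝓡 n) θ V q = (chartEquiv hθ (hs q)).symm (v q) := by
    rw [VectorField.mpullback_apply]
    have h3 : mfderiv (𝓡 n) (𝓡 n) θ q =
      (((chart_mdifferentiable hθ).mfderiv (hs q) :
        TangentSpace (𝓡 n) q ≃L[ℝ] TangentSpace (𝓡 n) (θ q)) : _ →L[ℝ] _) := rfl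
    rw [h3, ContinuousLinearMap.inverse_equiv]
    simp only [V, θ.left_inv (hs q)]
    rfl
  simp only [this]

end SmoothSections

/-! ### The flat connection of a global chart -/

section FlatConnection

variable {n : ℕ} {M : Type*} [TopologicalSpace M] [ChartedSpace (Coord n) M]
  {θ : OpenPartialHomeomorph M (Coord n)}

/-- The coordinates of a vector field in a chart. -/
def coordVec (θ : OpenPartialHomeomorph M (Coord n)) (σ : Π p : M, TangentSpace (𝓡 n) p) (p : M) :
    Coord n :=
  mvfderiv (𝓡 n) θ p (σ p)

theorem contMDiff_globalChart (hθ : θ ∈ IsManifold.maximalAtlas (𝓡 n) ∞ M)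
    (hs : ∀ p, p ∈ θ.source) : ContMDiff (𝓡 n) 𝓘(ℝ, Coord n) ∞ θ :=
  fun p => contMDiffAt_of_mem_maximalAtlas hθ (hs p)

theorem contDiffOn_comp_chart_symm (hθ : θ ∈ IsManifold.maximalAtlas (𝓡 n) ∞ M) {G : Type*}
    [NormedAddCommGroup G] [NormedSpace ℝ G] {f : M → G} (hf : ContMDiff (𝓡 n) 𝓘(ℝ, G) ∞ f) :
    ContDiffOn ℝ ∞ (f ∘ θ.symm) θ.target :=
  (hf.comp_contMDiffOn (contMDiffOn_symm_of_mem_maximalAtlas hθ)).contDiffOn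

theorem differentiableAt_comp_chart_symm (hθ : θ ∈ IsManifold.maximalAtlas (𝓡 n) ∞ M)
    (hs : ∀ p, p ∈ θ.source) {G : Type*}
    [NormedAddCommGroup G] [NormedSpace ℝ G] {f : M → G} {p : M}
    (hf : MDifferentiableAt (𝓡 n) 𝓘(ℝ, G) f p) :
    DifferentiableAt ℝ (f ∘ θ.symm) (θ p) := by
  rw [← mdifferentiableAt_iff_differentiableAt]
  refine MDifferentiableAt.comp (g := f) (θ p) (by rwa [θ.left_inv (hs p)]) ?_
  exact (chart_mdifferentiable hθ).mdifferentiableAt_symm (θ.map_source (hs p))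

theorem mvfderiv_eq_fderiv_comp_chart_symm (hθ : θ ∈ IsManifold.maximalAtlas (𝓡 n) ∞ M)
    (hs : ∀ p, p ∈ θ.source) {G : Type*}
    [NormedAddCommGroup G] [NormedSpace ℝ G] {f : M → G} {p : M}
    (hf : MDifferentiableAt (𝓡 n) 𝓘(ℝ, G) f p) :
    mvfderiv (𝓡 n) f p = (fderiv ℝ (f ∘ θ.symm) (θ p)).comp (mvfderiv (𝓡 n) θ p) :=
  mvfderiv_eq_of_eventuallyEq_comp_chart hθ (hs p)
    (Eventually.of_forall fun q => by simp [θ.left_inv (hs q)])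
    (differentiableAt_comp_chart_symm hθ hs hf)

/-- The push-forward of a vector field under a global chart. -/
def coordField (θ : OpenPartialHomeomorph M (Coord n)) (σ : Π p : M, TangentSpace (𝓡 n) p)
    (a : Coord n) : TangentSpace (𝓡 n) a :=
  (NormedSpace.fromTangentSpace (𝕜 := ℝ) a).symm ((coordVec θ σ ∘ θ.symm) a)

theorem mvfderiv_mpullback_globalChart (hθ : θ ∈ IsManifold.maximalAtlas (𝓡 n) ∞ M)
    (hs : ∀ p, p ∈ θ.source) (Y : Π a : Coord n, TangentSpace (𝓡 n) a) (p : M) :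
    mvfderiv (𝓡 n) θ p (VectorField.mpullback (𝓡 n) (𝓡 n) θ Y p) =
      NormedSpace.fromTangentSpace (𝕜 := ℝ) (θ p) (Y (θ p)) := by
  rw [VectorField.mpullback_apply]
  have h3 : mfderiv (𝓡 n) (𝓡 n) θ p =
      (((chart_mdifferentiable hθ).mfderiv (hs p) :
        TangentSpace (𝓡 n) p ≃L[ℝ] TangentSpace (𝓡 n) (θ p)) : _ →L[ℝ] _) := rfl
  rw [h3, ContinuousLinearMap.inverse_equiv]
  exact ((chart_mdifferentiable hθ).mfderiv (hs p)).apply_symm_apply _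

theorem mpullback_coordField (hθ : θ ∈ IsManifold.maximalAtlas (𝓡 n) ∞ M)
    (hs : ∀ p, p ∈ θ.source) (σ : Π p : M, TangentSpace (𝓡 n) p) :
    VectorField.mpullback (𝓡 n) (𝓡 n) θ (coordField θ σ) = σ := by
  funext q
  refine (chartEquiv hθ (hs q)).injective ?_
  rw [chartEquiv_apply, chartEquiv_apply, mvfderiv_mpullback_globalChart hθ hs, coordField,
    ContinuousLinearEquiv.apply_symm_apply, Function.comp_apply, θ.left_inv (hs q), coordVec]

theorem mdifferentiableAt_coordField (hθ : θ ∈ IsManifold.maximalAtlas (𝓡 n) ∞ M)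
    (hs : ∀ p, p ∈ θ.source) {σ : Π p : M, TangentSpace (𝓡 n) p} {p : M}
    (hσ : MDifferentiableAt (𝓡 n) 𝓘(ℝ, Coord n) (coordVec θ σ) p) :
    MDifferentiableAt (𝓡 n) (𝓡 n).tangent
      (fun a => (⟨a, coordField θ σ a⟩ : TangentBundle (𝓡 n) (Coord n))) (θ p) := by
  have h1 := differentiableAt_comp_chart_symm hθ hs hσ
  rw [← mdifferentiableAt_iff_differentiableAt] at h1
  rw [mdifferentiableAt_totalSpace]
  refine ⟨mdifferentiableAt_id, h1.congr_of_eventuallyEq (Eventually.of_forall fun a => ?_)⟩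
  simp
  rfl

variable [IsManifold (𝓡 n) ∞ M]

theorem contMDiff_coordVec (hθ : θ ∈ IsManifold.maximalAtlas (𝓡 n) ∞ M)
    (hs : ∀ p, p ∈ θ.source) (V : VField n M) :
    ContMDiff (𝓡 n) 𝓘(ℝ, Coord n) ∞ (coordVec θ V) :=
  fun q => contMDiffAt_mvfderiv_apply (contMDiff_globalChart hθ hs) (V.contMDiff q)

theorem mdifferentiableAt_coordVec (hθ : θ ∈ IsManifold.maximalAtlas (𝓡 n) ∞ M)
    (hs : ∀ p, p ∈ θ.source) {σ : Π p : M, TangentSpace (𝓡 n) p} {p : M}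
    (hσ : MDifferentiableAt (𝓡 n) (𝓡 n).tangent
      (fun q => (⟨q, σ q⟩ : TangentBundle (𝓡 n) M)) p) :
    MDifferentiableAt (𝓡 n) 𝓘(ℝ, Coord n) (coordVec θ σ) p :=
  mdifferentiableAt_mvfderiv_apply (contMDiff_globalChart hθ hs) hσ

/-- Naturality of the Lie bracket under pull-back reduces this to the bracket formula in `ℝⁿ`.
Differentiability at `p` alone is assumed, as the torsion criterion requires. -/
theorem mvfderiv_mlieBracket (hθ : θ ∈ IsManifold.maximalAtlas (𝓡 n) ∞ M)
    (hs : ∀ p, p ∈ θ.source) {V W : Π p : M, TangentSpace (𝓡 n) p} {p : M}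
    (hV : MDifferentiableAt (𝓡 n) (𝓡 n).tangent (fun q => (⟨q, V q⟩ : TangentBundle (𝓡 n) M)) p)
    (hW : MDifferentiableAt (𝓡 n) (𝓡 n).tangent (fun q => (⟨q, W q⟩ : TangentBundle (𝓡 n) M)) p) :
    mvfderiv (𝓡 n) θ p (VectorField.mlieBracket (𝓡 n) V W p) =
      mvfderiv (𝓡 n) (coordVec θ W) p (V p) - mvfderiv (𝓡 n) (coordVec θ V) p (W p) := by
  have hsm := contMDiff_globalChart hθ hs
  have hV' := mdifferentiableAt_coordVec hθ hs hV
  have hW' := mdifferentiableAt_coordVec hθ hs hW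
  have : IsManifold (𝓡 n) (minSmoothness ℝ 2) M := by
    rw [minSmoothness_of_isRCLikeNormedField]; infer_instance
  have key := VectorField.mpullback_mlieBracket (f := θ) (n := ∞)
    (mdifferentiableAt_coordField hθ hs hV') (mdifferentiableAt_coordField hθ hs hW') (hsm p)
    (by simpa using (WithTop.coe_le_coe.2 le_top : ((2 : ℕ∞) : WithTop ℕ∞) ≤ ∞))
  rw [mpullback_coordField hθ hs, mpullback_coordField hθ hs] at key
  have hbr : VectorField.mlieBracket (𝓡 n) (coordField θ V) (coordField θ W) (θ p) =
      VectorField.lieBracket ℝ (coordVec θ V ∘ θ.symm) (coordVec θ W ∘ θ.symm) (θ p) := by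
    rw [← VectorField.mlieBracketWithin_univ, ← VectorField.lieBracketWithin_univ,
      VectorField.mlieBracketWithin_eq_lieBracketWithin]
    rfl
  rw [← key, mvfderiv_mpullback_globalChart hθ hs, hbr,
    mvfderiv_eq_fderiv_comp_chart_symm hθ hs hV', mvfderiv_eq_fderiv_comp_chart_symm hθ hs hW']
  change VectorField.lieBracket ℝ _ _ (θ p) = _
  simp only [VectorField.lieBracket, ContinuousLinearMap.comp_apply, Function.comp_apply,
    θ.left_inv (hs p)]
  rfl

/-- The directional derivatives of a function commute up to the Lie bracket. -/
theorem mvfderiv_mvfderiv_sub_swap (hθ : θ ∈ IsManifold.maximalAtlas (𝓡 n) ∞ M)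
    (hs : ∀ p, p ∈ θ.source) {G : Type*} [NormedAddCommGroup G] [NormedSpace ℝ G] {f : M → G}
    (hf : ContMDiff (𝓡 n) 𝓘(ℝ, G) ∞ f) (V W : VField n M) (p : M) :
    mvfderiv (𝓡 n) (fun q => mvfderiv (𝓡 n) f q (W q)) p (V p)
      - mvfderiv (𝓡 n) (fun q => mvfderiv (𝓡 n) f q (V q)) p (W p) =
      mvfderiv (𝓡 n) f p (VectorField.mlieBracket (𝓡 n) V W p) := by
  have hsm := contMDiff_globalChart hθ hs
  have hmd : ∀ q, MDifferentiableAt (𝓡 n) 𝓘(ℝ, G) f q := fun q =>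
    (hf q).mdifferentiableAt (by simp)
  have hF := contDiffOn_comp_chart_symm hθ hf
  set F := f ∘ θ.symm with hFdef
  have hFp := hF.contDiffAt (θ.open_target.mem_nhds (θ.map_source (hs p)))
  have hU := contMDiff_coordVec (n := n) hθ hs
  -- Product rule: a second derivative term plus the derivative of the coordinates of `U`. In the
  -- commutator the first parts cancel by symmetry and the second parts form the bracket.
  have hsecond : ∀ U : VField n M, ∀ v : TangentSpace (𝓡 n) p,
      mvfderiv (𝓡 n) (fun q => mvfderiv (𝓡 n) f q (U q)) p v =
      fderiv ℝ (fderiv ℝ F) (θ p) (mvfderiv (𝓡 n) θ p v) (coordVec θ U p) +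
        fderiv ℝ F (θ p) (mvfderiv (𝓡 n) (coordVec θ U) p v) := by
    intro U v
    have hu := contDiffOn_comp_chart_symm hθ (hU U)
    have hud : DifferentiableAt ℝ (coordVec θ U ∘ θ.symm) (θ p) :=
      (hu.contDiffAt (θ.open_target.mem_nhds (θ.map_source (hs p)))).differentiableAt (by simp)
    have hFd : DifferentiableAt ℝ (fderiv ℝ F) (θ p) :=
      (hFp.fderiv_right (m := ∞) (by simp)).differentiableAt (by simp)
    rw [mvfderiv_eq_of_eventuallyEq_comp_chart hθ (hs p)
      (F := fun a => fderiv ℝ F a ((coordVec θ U ∘ θ.symm) a)) ?_ (hFd.clm_apply hud),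
      mvfderiv_eq_fderiv_comp_chart_symm hθ hs ((hU U p).mdifferentiableAt (by simp)),
      ContinuousLinearMap.comp_apply, fderiv_clm_apply hFd hud]
    · simp [θ.left_inv (hs p), add_comm]
    · refine Eventually.of_forall fun q => ?_
      simp only [mvfderiv_eq_fderiv_comp_chart_symm hθ hs (hmd q), Function.comp_apply,
        θ.left_inv (hs q), ContinuousLinearMap.comp_apply]
      rfl
  rw [hsecond, hsecond, mvfderiv_eq_fderiv_comp_chart_symm hθ hs (hmd p),
    ContinuousLinearMap.comp_apply,
    mvfderiv_mlieBracket hθ hs ((V.contMDiff p).mdifferentiableAt (by simp))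
      ((W.contMDiff p).mdifferentiableAt (by simp)), map_sub]
  have hsymm : IsSymmSndFDerivAt ℝ F (θ p) := hFp.isSymmSndFDerivAt (by
    simpa using (WithTop.coe_le_coe.2 le_top : ((2 : ℕ∞) : WithTop ℕ∞) ≤ ∞))
  have := hsymm (mvfderiv (𝓡 n) θ p (V p)) (mvfderiv (𝓡 n) θ p (W p))
  simp only [coordVec] at this ⊢
  rw [this]
  abel

/-- The connection whose coordinates with respect to a global chart are the usual derivatives. -/
def flatConnection (hθ : θ ∈ IsManifold.maximalAtlas (𝓡 n) ∞ M) (hs : ∀ p, p ∈ θ.source) :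
    Connection n M where
  toFun σ p := ((chartEquiv hθ (hs p)).symm : Coord n →L[ℝ] TangentSpace (𝓡 n) p).comp
    (mvfderiv (𝓡 n) (coordVec θ σ) p)
  isCovariantDerivativeOnUniv :=
    { add := fun {σ σ' p} hσ hσ' _ => by
        have : coordVec θ (σ + σ') = coordVec θ σ + coordVec θ σ' := by
          funext q; simp [coordVec]
        rw [this, mvfderiv_add (mdifferentiableAt_coordVec hθ hs hσ)
          (mdifferentiableAt_coordVec hθ hs hσ'), ContinuousLinearMap.comp_add]
      leibniz := fun {σ g p} hσ hg _ => by
        have : coordVec θ (g • σ) = g • coordVec θ σ := by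
          funext q; simp [coordVec]
        rw [this, mvfderiv_smul hg (mdifferentiableAt_coordVec hθ hs hσ)]
        ext v
        simp [coordVec, ← chartEquiv_apply hθ (hs p)] }

theorem mvfderiv_flatConnection (hθ : θ ∈ IsManifold.maximalAtlas (𝓡 n) ∞ M)
    (hs : ∀ p, p ∈ θ.source) (σ : Π p : M, TangentSpace (𝓡 n) p) (p : M)
    (v : TangentSpace (𝓡 n) p) :
    mvfderiv (𝓡 n) θ p (flatConnection hθ hs σ p v) = mvfderiv (𝓡 n) (coordVec θ σ) p v :=
  (chartEquiv hθ (hs p)).apply_symm_apply _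

theorem contMDiff_flatConnection (hθ : θ ∈ IsManifold.maximalAtlas (𝓡 n) ∞ M)
    (hs : ∀ p, p ∈ θ.source) :
    CovariantDerivative.ContMDiffCovariantDerivative (flatConnection hθ hs) ∞ where
  contMDiff := ⟨fun {σ} hσ => by
    rw [contMDiffOn_univ] at hσ ⊢
    intro p
    have hsm := contMDiff_globalChart hθ hs
    have hc : ContMDiff (𝓡 n) 𝓘(ℝ, Coord n) ∞ (coordVec θ σ) := fun q =>
      contMDiffAt_mvfderiv_apply hsm ((hσ q).of_le (by simp))
    refine contMDiffAt_hom_of_forall fun s hs' => ?_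
    exact contMDiffAt_chartEquiv_symm hθ hs (contMDiffAt_mvfderiv_apply hc hs')⟩

/-- In coordinates the torsion equation is the bracket formula, and the curvature equation is the
commutator identity for the vector-valued function `coordVec θ Z`. -/
theorem isFlat_flatConnection (hθ : θ ∈ IsManifold.maximalAtlas (𝓡 n) ∞ M)
    (hs : ∀ p, p ∈ θ.source) : IsFlat (flatConnection hθ hs) := by
  have hsm := contMDiff_globalChart hθ hs
  refine ⟨?_, fun V W Z p => ?_⟩
  · rw [CovariantDerivative.torsion_eq_zero_iff]
    intro V W p hV hW
    refine (chartEquiv hθ (hs p)).injective ?_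
    simp only [map_sub, chartEquiv_apply, mvfderiv_flatConnection]
    exact (mvfderiv_mlieBracket hθ hs hV hW).symm
  · refine (chartEquiv hθ (hs p)).injective ?_
    have hc : ∀ U : VField n M, coordVec θ (fun q => flatConnection hθ hs Z q (U q)) =
        fun q => mvfderiv (𝓡 n) (coordVec θ Z) q (U q) := fun U =>
      funext fun q => mvfderiv_flatConnection hθ hs Z q (U q)
    simp only [curvature, map_sub, map_zero, chartEquiv_apply, mvfderiv_flatConnection, hc]
    rw [mvfderiv_mvfderiv_sub_swap hθ hs (contMDiff_coordVec hθ hs Z), sub_self]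

end FlatConnection

/-- The unit ball of a positive definite form on a finite-dimensional space is bounded. -/
theorem isVonNBounded_of_pos {E : Type*} [NormedAddCommGroup E] [NormedSpace ℝ E]
    [FiniteDimensional ℝ E] (B : E →L[ℝ] E →L[ℝ] ℝ) (hB : ∀ v, v ≠ 0 → 0 < B v v) :
    Bornology.IsVonNBounded ℝ {v | B v v < 1} := by
  have : ProperSpace E := FiniteDimensional.proper ℝ E
  rw [NormedSpace.isVonNBounded_iff]
  -- `m` is the minimum of the form on the unit sphere; when the sphere is empty, as in dimension
  -- zero, any positive value serves.
  obtain ⟨m, hm, hm'⟩ : ∃ m > 0, ∀ v ∈ Metric.sphere (0 : E) 1, m ≤ B v v := by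
    rcases (Metric.sphere (0 : E) 1).eq_empty_or_nonempty with he | hne
    · exact ⟨1, one_pos, by simp [he]⟩
    · obtain ⟨v, hv, hmin⟩ := (isCompact_sphere (0 : E) 1).exists_isMinOn hne
        (f := fun v => B v v) (B.continuous.clm_apply continuous_id).continuousOn
      exact ⟨B v v, hB v (ne_zero_of_mem_unit_sphere ⟨v, hv⟩), hmin⟩
  refine (Metric.isBounded_iff_subset_closedBall 0).2 ⟨Real.sqrt (1 / m), fun v hv => ?_⟩
  rw [mem_closedBall_zero_iff]
  refine Real.le_sqrt_of_sq_le ?_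
  rcases eq_or_ne v 0 with rfl | hv0
  · simp; positivity
  have hn : ‖v‖ ≠ 0 := norm_ne_zero_iff.2 hv0
  have h1 := hm' (‖v‖⁻¹ • v) (by simp [norm_smul, hn])
  simp only [map_smul, smul_apply, smul_eq_mul] at h1
  have hv : B v v < 1 := hv
  rw [le_div_iff₀ hm]
  have h2 : m * ‖v‖ ^ 2 ≤ B v v := by
    calc m * ‖v‖ ^ 2 ≤ (‖v‖⁻¹ * (‖v‖⁻¹ * B v v)) * ‖v‖ ^ 2 := by gcongr
      _ = B v v := by field_simp
  linarith

/-! ### Riemannian metrics given by coefficients in a global chart -/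

section FlatMetric

variable {n : ℕ} {M : Type*} [TopologicalSpace M] [ChartedSpace (Coord n) M]
  {θ : OpenPartialHomeomorph M (Coord n)}

/-- The pull-back of a bilinear form under the differential of a function. -/
def pullbackForm (θ : M → Coord n) (B : Coord n →L[ℝ] Coord n →L[ℝ] ℝ) (p : M) :
    TangentSpace (𝓡 n) p →L[ℝ] TangentSpace (𝓡 n) p →L[ℝ] ℝ :=
  (ContinuousLinearMap.precomp ℝ (mvfderiv (𝓡 n) θ p)).comp (B.comp (mvfderiv (𝓡 n) θ p))

variable [IsManifold (𝓡 n) ∞ M]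

/-- The Riemannian metric with given coefficients in a global chart. -/
def chartMetric (hθ : θ ∈ IsManifold.maximalAtlas (𝓡 n) ∞ M)
    (hs : ∀ p, p ∈ θ.source) (B : Coord n → Coord n →L[ℝ] Coord n →L[ℝ] ℝ)
    (hB : ContDiffOn ℝ ∞ B θ.target) (hsymm : ∀ p v w, B (θ p) v w = B (θ p) w v)
    (hpos : ∀ p v, v ≠ 0 → 0 < B (θ p) v v) : Metric n M where
  inner p := pullbackForm θ (B (θ p)) p
  symm p v w := hsymm p _ _
  pos p v hv := hpos p _ fun h =>
    hv ((chartEquiv hθ (hs p)).map_eq_zero_iff.1 h)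
  isVonNBounded p := by
    have h1 := (isVonNBounded_of_pos (B (θ p)) (hpos p)).image
      ((chartEquiv hθ (hs p)).symm : Coord n →L[ℝ] TangentSpace (𝓡 n) p)
    have h2 : {v : TangentSpace (𝓡 n) p | pullbackForm θ (B (θ p)) p v v < 1} ⊆
        ((chartEquiv hθ (hs p)).symm : Coord n →L[ℝ] TangentSpace (𝓡 n) p) ''
          {v | B (θ p) v v < 1} := fun v hv =>
      ⟨chartEquiv hθ (hs p) v, hv, (chartEquiv hθ (hs p)).symm_apply_apply v⟩
    exact h1.subset h2
  contMDiff p := by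
    have hsm := contMDiff_globalChart hθ hs
    -- The criterion is applied once for each slot of the bilinear form.
    refine contMDiffAt_hom_of_forall (E₂ := fun b => TangentSpace (𝓡 n) b →L[ℝ] Trivial M ℝ b)
      fun σ hσ => ?_
    refine contMDiffAt_hom_of_forall (E₂ := Trivial M ℝ) fun σ' hσ' => ?_
    rw [contMDiffAt_totalSpace]
    refine ⟨contMDiffAt_id, ?_⟩
    have h1 := contMDiffAt_mvfderiv_apply hsm hσ
    have h2 := contMDiffAt_mvfderiv_apply hsm hσ'
    have h3 : ContMDiffAt (𝓡 n) 𝓘(ℝ, Coord n →L[ℝ] Coord n →L[ℝ] ℝ) ∞ (fun q => B (θ q)) p :=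
      (hB.contDiffAt (θ.open_target.mem_nhds (θ.map_source (hs p)))).contMDiffAt.comp p (hsm p)
    exact (h3.clm_apply h1).clm_apply h2

end FlatMetric

/-! ### Integrals of functions of `⟨a, T x⟩ - c x - ψ a` -/

section DualIntegral

/-- The function `⟨a, T x⟩ - c x - ψ a`. -/
def dualCoord {n : ℕ} {X : Type*} (T : X → Coord n) (c : X → ℝ) (ψ : Coord n → ℝ) (x : X)
    (a : Coord n) : ℝ :=
  inner ℝ a (T x) - c x - ψ a

/-- The differential of `⟨a, T x⟩ - c x - ψ a` in `a`. -/
def dualCoordDeriv {n : ℕ} {X : Type*} (T : X → Coord n) (ψ : Coord n → ℝ) (x : X)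
    (a : Coord n) : Coord n →L[ℝ] ℝ :=
  innerSL ℝ (T x) - fderiv ℝ ψ a

variable {n : ℕ} {X : Type*} {T : X → Coord n} {c : X → ℝ} {ψ : Coord n → ℝ}
  {O : Set (Coord n)} {J : Set ℝ} {g : ℝ → ℝ}

theorem dualCoordDeriv_apply (x : X) (a v : Coord n) :
    dualCoordDeriv T ψ x a v = inner ℝ v (T x) - fderiv ℝ ψ a v := by
  simp [dualCoordDeriv, real_inner_comm]

theorem hasFDerivAt_dualCoord {x : X} {a : Coord n} (hψ : DifferentiableAt ℝ ψ a) :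
    HasFDerivAt (dualCoord T c ψ x) (dualCoordDeriv T ψ x a) a := by
  have h1 := (((innerSL ℝ (T x)).hasFDerivAt (x := a)).sub_const (c x)).sub hψ.hasFDerivAt
  refine h1.congr_of_eventuallyEq (Eventually.of_forall fun z => ?_)
  simp [dualCoord, real_inner_comm]

theorem continuous_dualCoord [TopologicalSpace X] (hT : Continuous T) (hc : Continuous c)
    (a : Coord n) : Continuous fun x => dualCoord T c ψ x a := by
  unfold dualCoord
  fun_prop

theorem continuous_dualCoordDeriv [TopologicalSpace X] (hT : Continuous T) (a v : Coord n) :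
    Continuous fun x => dualCoordDeriv T ψ x a v := by
  simp only [dualCoordDeriv_apply]
  fun_prop

variable [TopologicalSpace X] [CompactSpace X] [MeasurableSpace X] [BorelSpace X]
  {μ : Measure X} [IsFiniteMeasureOnCompacts μ]
  {F : Type} [NormedAddCommGroup F] [NormedSpace ℝ F]

/-- Smoothness of the integrals `∫ g(⟨a, T x⟩ - c x - ψ a) • w x dμ(x)` in `a`, and
differentiation under the integral sign. -/
theorem dualIntegral_smooth (hO : IsOpen O) (hJ : IsOpen J) (hT : Continuous T)
    (hc : Continuous c) (hψ : ContDiffOn ℝ ∞ ψ O) (hg : ContDiffOn ℝ ∞ g J)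
    (hu : ∀ a ∈ O, ∀ x, dualCoord T c ψ x a ∈ J) {w : X → F} (hw : Continuous w) :
    ContDiffOn ℝ ∞ (fun a => ∫ x, g (dualCoord T c ψ x a) • w x ∂μ) O ∧
    ∀ a ∈ O, ∀ v, fderiv ℝ (fun a => ∫ x, g (dualCoord T c ψ x a) • w x ∂μ) a v =
      ∫ x, (deriv g (dualCoord T c ψ x a) * dualCoordDeriv T ψ x a v) • w x ∂μ := by
  -- `X` has no smooth structure: the sample point enters only through `(T x, c x, w x)`, so the
  -- integrand is one smooth function `Φ` on an open set, evaluated along a continuous map from `X`.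
  let Y := Coord n × ℝ × F
  let U : Y × Coord n → ℝ := fun z => inner ℝ z.2 z.1.1 - z.1.2.1 - ψ z.2
  let Φ : Y × Coord n → F := fun z => g (U z) • z.1.2.2
  let y : X → Y := fun x => (T x, c x, w x)
  have hy : Continuous y := by fun_prop
  have hU : ContDiffOn ℝ ∞ U (Prod.snd ⁻¹' O) := by
    have h1 : ContDiff ℝ ∞ fun z : Y × Coord n => (inner ℝ z.2 z.1.1 : ℝ) - z.1.2.1 :=
      (contDiff_snd.inner ℝ (contDiff_fst.comp contDiff_fst)).sub
        (contDiff_fst.comp (contDiff_snd.comp contDiff_fst))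
    exact h1.contDiffOn.sub (hψ.comp contDiff_snd.contDiffOn fun z hz => hz)
  let Ω : Set (Y × Coord n) := (Prod.snd ⁻¹' O) ∩ U ⁻¹' J
  have hΩ : IsOpen Ω := hU.continuousOn.isOpen_inter_preimage (hO.preimage continuous_snd) hJ
  have hΦ : ContDiffOn ℝ ∞ Φ Ω := by
    refine ContDiffOn.smul (hg.comp (hU.mono inter_subset_left) fun z hz => hz.2) ?_
    exact (contDiff_snd.comp (contDiff_snd.comp contDiff_fst)).contDiffOn
  have hmem : ∀ a ∈ O, ∀ x, (y x, a) ∈ Ω := fun a ha x => ⟨ha, hu a ha x⟩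
  refine ⟨contDiffOn_integral_comp_prodMk (μ := μ) hΩ hΦ hy hO hmem, fun a ha v => ?_⟩
  have h1 := (hasFDerivAt_integral_comp_prodMk (μ := μ) hΩ hΦ hy (hmem a ha)).fderiv
  have hcont := continuous_comp_prodMk (hΦ.sndFDeriv hΩ).continuousOn hy (hmem a ha)
  refine (congrArg (fun L => L v) h1).trans ?_
  rw [ContinuousLinearMap.integral_apply (integrable_of_continuous_of_compactSpace hcont)]
  congr 1
  funext x
  have h2 : HasFDerivAt (fun a => Φ (y x, a)) (sndFDeriv Φ (y x, a)) a :=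
    hasFDerivAt_sndFDeriv ((hΦ.contDiffAt (hΩ.mem_nhds (hmem a ha x))).differentiableAt (by simp))
  have hψa : DifferentiableAt ℝ ψ a :=
    (hψ.contDiffAt (hO.mem_nhds ha)).differentiableAt (by simp)
  have hga : HasDerivAt g (deriv g (dualCoord T c ψ x a)) (dualCoord T c ψ x a) :=
    ((hg.contDiffAt (hJ.mem_nhds (hu a ha x))).differentiableAt (by simp)).hasDerivAt
  have h3 := (hga.comp_hasFDerivAt a (hasFDerivAt_dualCoord hψa)).smul_const (w x)
  rw [h2.unique h3]
  simp

end DualIntegral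

/-! ### Mixed derivatives of Bregman forms -/

section BregmanForm

variable {n : ℕ} {M : Type*} [TopologicalSpace M] [ChartedSpace (Coord n) M]
  [IsManifold (𝓡 n) ∞ M] {θ : OpenPartialHomeomorph M (Coord n)}

theorem dirDeriv_comp_globalChart (hθ : θ ∈ IsManifold.maximalAtlas (𝓡 n) ∞ M)
    (hs : ∀ p, p ∈ θ.source) (V : VField n M) {G : Coord n → ℝ} {p : M}
    (hG : DifferentiableAt ℝ G (θ p)) :
    dirDeriv V (fun q => G (θ q)) p = fderiv ℝ G (θ p) (coordVec θ V p) := by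
  unfold dirDeriv
  rw [mvfderiv_eq_of_eventuallyEq_comp_chart hθ (hs p) (f := fun q => G (θ q))
    (Eventually.of_forall fun q => rfl) hG]
  rfl

theorem fderiv_coordVec_comp_symm (hθ : θ ∈ IsManifold.maximalAtlas (𝓡 n) ∞ M)
    (hs : ∀ p, p ∈ θ.source) (V Z : VField n M) (p : M) :
    fderiv ℝ (coordVec θ V ∘ θ.symm) (θ p) (coordVec θ Z p) =
      mvfderiv (𝓡 n) (coordVec θ V) p (Z p) := by
  rw [mvfderiv_eq_fderiv_comp_chart_symm hθ hs
    ((contMDiff_coordVec hθ hs V p).mdifferentiableAt (by simp))]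
  rfl

theorem differentiableAt_coordVec_comp_symm (hθ : θ ∈ IsManifold.maximalAtlas (𝓡 n) ∞ M)
    (hs : ∀ p, p ∈ θ.source) (V : VField n M) (p : M) :
    DifferentiableAt ℝ (coordVec θ V ∘ θ.symm) (θ p) :=
  differentiableAt_comp_chart_symm hθ hs
    ((contMDiff_coordVec hθ hs V p).mdifferentiableAt (by simp))

/-- The two-point function `A(p) + B(q) - ⟨θ(q), η(p)⟩ + s(p) ψ(q)`. -/
def bregmanForm (θ : M → Coord n) (A B s ψ : Coord n → ℝ) (η : Coord n → Coord n) (p q : M) : ℝ :=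
  A (θ p) + B (θ q) - inner ℝ (θ q) (η (θ p)) + s (θ p) * ψ (θ q)

variable {A B s ψ : Coord n → ℝ} {η : Coord n → Coord n}

/-- Terms in one point only drop out. The coefficients are arbitrary because the formula serves both
the divergence and its integrand at each fixed sample point. -/
theorem fstDeriv_sndDeriv_bregmanForm (hθ : θ ∈ IsManifold.maximalAtlas (𝓡 n) ∞ M)
    (hs : ∀ p, p ∈ θ.source) (hB : ∀ p, DifferentiableAt ℝ B (θ p))
    (hsd : ∀ p, DifferentiableAt ℝ s (θ p)) (hψ : ∀ p, DifferentiableAt ℝ ψ (θ p))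
    (hη : ∀ p, DifferentiableAt ℝ η (θ p)) (V W : VField n M) (p q : M) :
    fstDeriv V (sndDeriv W (bregmanForm θ A B s ψ η)) p q =
      -inner ℝ (coordVec θ W q) (fderiv ℝ η (θ p) (coordVec θ V p))
        + fderiv ℝ s (θ p) (coordVec θ V p) * fderiv ℝ ψ (θ q) (coordVec θ W q) := by
  have h1 : ∀ p, sndDeriv W (bregmanForm θ A B s ψ η) p q =
      fderiv ℝ B (θ q) (coordVec θ W q) - inner ℝ (coordVec θ W q) (η (θ p))
        + s (θ p) * fderiv ℝ ψ (θ q) (coordVec θ W q) := by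
    intro p
    have hd : HasFDerivAt (fun b => A (θ p) + B b - inner ℝ b (η (θ p)) + s (θ p) * ψ b)
        (fderiv ℝ B (θ q) - innerSL ℝ (η (θ p)) + s (θ p) • fderiv ℝ ψ (θ q)) (θ q) := by
      have h2 := (innerSL ℝ (η (θ p))).hasFDerivAt (x := θ q)
      have h3 := (((hB q).hasFDerivAt.const_add (A (θ p))).sub h2).add
        ((hψ q).hasFDerivAt.const_mul (s (θ p)))
      refine h3.congr_of_eventuallyEq (Eventually.of_forall fun b => ?_)
      simp [real_inner_comm]
    have := dirDeriv_comp_globalChart hθ hs W hd.differentiableAt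
    rw [hd.fderiv] at this
    refine this.trans ?_
    simp [real_inner_comm]
  simp only [fstDeriv, h1]
  have hd : HasFDerivAt (fun a => fderiv ℝ B (θ q) (coordVec θ W q)
      - inner ℝ (coordVec θ W q) (η a) + s a * fderiv ℝ ψ (θ q) (coordVec θ W q))
      (-(innerSL ℝ (coordVec θ W q)).comp (fderiv ℝ η (θ p)) +
        (fderiv ℝ ψ (θ q) (coordVec θ W q)) • fderiv ℝ s (θ p)) (θ p) := by
    have h2 := (innerSL ℝ (coordVec θ W q)).hasFDerivAt.comp (θ p) (hη p).hasFDerivAt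
    exact (h2.const_sub _).add ((hsd p).hasFDerivAt.mul_const _)
  rw [dirDeriv_comp_globalChart hθ hs V hd.differentiableAt, hd.fderiv]
  simp [mul_comm]

/-- The pairing is linear in `θ q`, so its second derivative in `q` sees only the change of the
coordinates of `V`. This is the term that makes `θ` affine for the induced connection. -/
theorem sndDeriv_sndDeriv_fstDeriv_bregmanForm (hθ : θ ∈ IsManifold.maximalAtlas (𝓡 n) ∞ M)
    (hs : ∀ p, p ∈ θ.source) (hA : ∀ p, DifferentiableAt ℝ A (θ p))
    (hsd : ∀ p, DifferentiableAt ℝ s (θ p)) (hψ : ContDiffOn ℝ ∞ ψ θ.target)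
    (hη : ∀ p, DifferentiableAt ℝ η (θ p)) (V W Z : VField n M) (p q : M) :
    sndDeriv Z (sndDeriv V (fstDeriv W (bregmanForm θ A B s ψ η))) p q =
      -inner ℝ (mvfderiv (𝓡 n) (coordVec θ V) q (Z q)) (fderiv ℝ η (θ p) (coordVec θ W p))
        + fderiv ℝ s (θ p) (coordVec θ W p) *
          dirDeriv Z (fun q => fderiv ℝ ψ (θ q) (coordVec θ V q)) q := by
  have hψc : ∀ q, ContDiffAt ℝ ∞ ψ (θ q) := fun q =>
    hψ.contDiffAt (θ.open_target.mem_nhds (θ.map_source (hs q)))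
  have hψd : ∀ q, DifferentiableAt ℝ ψ (θ q) := fun q => (hψc q).differentiableAt (by simp)
  set m := fderiv ℝ η (θ p) (coordVec θ W p) with hm
  set k := fderiv ℝ s (θ p) (coordVec θ W p) with hk
  have h1 : ∀ q, fstDeriv W (bregmanForm θ A B s ψ η) p q =
      fderiv ℝ A (θ p) (coordVec θ W p) - inner ℝ (θ q) m + k * ψ (θ q) := by
    intro q
    have hd : HasFDerivAt (fun a => A a + B (θ q) - inner ℝ (θ q) (η a) + s a * ψ (θ q))
        (fderiv ℝ A (θ p) - (innerSL ℝ (θ q)).comp (fderiv ℝ η (θ p))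
          + ψ (θ q) • fderiv ℝ s (θ p)) (θ p) := by
      have h2 := (innerSL ℝ (θ q)).hasFDerivAt.comp (θ p) (hη p).hasFDerivAt
      exact (((hA p).hasFDerivAt.add_const (B (θ q))).sub h2).add
        ((hsd p).hasFDerivAt.mul_const (ψ (θ q)))
    have := dirDeriv_comp_globalChart hθ hs W hd.differentiableAt
    rw [hd.fderiv] at this
    refine this.trans ?_
    simp [hm, hk, mul_comm]
  have h2 : ∀ q, sndDeriv V (fstDeriv W (bregmanForm θ A B s ψ η)) p q =
      -inner ℝ (coordVec θ V q) m + k * fderiv ℝ ψ (θ q) (coordVec θ V q) := by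
    intro q
    simp only [sndDeriv, h1]
    have hd : HasFDerivAt (fun b => fderiv ℝ A (θ p) (coordVec θ W p) - inner ℝ b m + k * ψ b)
        (-innerSL ℝ m + k • fderiv ℝ ψ (θ q)) (θ q) := by
      have h3 := (((innerSL ℝ m).hasFDerivAt (x := θ q)).const_sub
        (fderiv ℝ A (θ p) (coordVec θ W p))).add ((hψd q).hasFDerivAt.const_mul k)
      refine h3.congr_of_eventuallyEq (Eventually.of_forall fun b => ?_)
      simp [real_inner_comm]
    rw [dirDeriv_comp_globalChart hθ hs V hd.differentiableAt, hd.fderiv]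
    simp [real_inner_comm]
  rw [sndDeriv]
  simp only [h2]
  have hvd := differentiableAt_coordVec_comp_symm hθ hs V q
  have hDψ : DifferentiableAt ℝ (fderiv ℝ ψ) (θ q) :=
    ((hψc q).fderiv_right (m := ∞) (by simp)).differentiableAt (by simp)
  have hG2 : DifferentiableAt ℝ (fun a => fderiv ℝ ψ a ((coordVec θ V ∘ θ.symm) a)) (θ q) :=
    hDψ.clm_apply hvd
  have e1 : (fun q => fderiv ℝ ψ (θ q) (coordVec θ V q)) =
      fun q => (fun a => fderiv ℝ ψ a ((coordVec θ V ∘ θ.symm) a)) (θ q) := by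
    funext q; simp [θ.left_inv (hs q)]
  have e2 : (fun q => -inner ℝ (coordVec θ V q) m + k * fderiv ℝ ψ (θ q) (coordVec θ V q)) =
      fun q => (fun a => -inner ℝ m ((coordVec θ V ∘ θ.symm) a) +
        k * fderiv ℝ ψ a ((coordVec θ V ∘ θ.symm) a)) (θ q) := by
    funext q; simp [θ.left_inv (hs q), real_inner_comm]
  have hd : HasFDerivAt (fun a => -inner ℝ m ((coordVec θ V ∘ θ.symm) a) +
        k * fderiv ℝ ψ a ((coordVec θ V ∘ θ.symm) a))
      (-(innerSL ℝ m).comp (fderiv ℝ (coordVec θ V ∘ θ.symm) (θ q)) +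
        k • fderiv ℝ (fun a => fderiv ℝ ψ a ((coordVec θ V ∘ θ.symm) a)) (θ q)) (θ q) :=
    ((innerSL ℝ m).hasFDerivAt.comp (θ q) hvd.hasFDerivAt).neg.add
      (hG2.hasFDerivAt.const_mul k)
  rw [e2, dirDeriv_comp_globalChart hθ hs Z hd.differentiableAt, hd.fderiv, e1,
    dirDeriv_comp_globalChart hθ hs Z hG2]
  simp only [add_apply, neg_apply, smul_apply, ContinuousLinearMap.comp_apply, innerSL_apply_apply,
    smul_eq_mul]
  rw [fderiv_coordVec_comp_symm hθ hs, real_inner_comm]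

end BregmanForm

theorem integral_add_add_sub_add {X : Type*} [MeasurableSpace X] {μ : Measure X}
    {f₁ f₂ f₃ f₄ f₅ : X → ℝ} (h₁ : Integrable f₁ μ) (h₂ : Integrable f₂ μ) (h₃ : Integrable f₃ μ)
    (h₄ : Integrable f₄ μ) (h₅ : Integrable f₅ μ) :
    ∫ x, (f₁ x + f₂ x + f₃ x - f₄ x + f₅ x) ∂μ =
      ∫ x, f₁ x ∂μ + ∫ x, f₂ x ∂μ + ∫ x, f₃ x ∂μ - ∫ x, f₄ x ∂μ + ∫ x, f₅ x ∂μ := by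
  rw [integral_add (f := fun x => f₁ x + f₂ x + f₃ x - f₄ x) (((h₁.add h₂).add h₃).sub h₄) h₅,
    integral_sub (f := fun x => f₁ x + f₂ x + f₃ x) ((h₁.add h₂).add h₃) h₄,
    integral_add (f := fun x => f₁ x + f₂ x) (h₁.add h₂) h₃, integral_add h₁ h₂]

/-! ### The divergence in a global exponential chart -/

section GlobalRepresentation

variable {n : ℕ} {X : Type*} [TopologicalSpace X]
  {M : Type*} [TopologicalSpace M] [ChartedSpace (Coord n) M]
  {h τ : ℝ → ℝ} {I : Set ℝ} {ρ : M → X → ℝ}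
  {θ : OpenPartialHomeomorph M (Coord n)} {T : X → Coord n} {c : X → ℝ} {ψ : M → ℝ}

theorem IsExpCoordRep.dualCoord_eq (R : IsExpCoordRep h τ I ρ θ T c ψ) (hs : ∀ p, p ∈ θ.source)
    (p : M) (x : X) : dualCoord T c (ψ ∘ θ.symm) x (θ p) = deriv h (τ (ρ p x)) := by
  rw [R.eq p (hs p) x, dualCoord, Function.comp_apply, θ.left_inv (hs p)]

theorem IsExpCoordRep.dualCoord_mem (R : IsExpCoordRep h τ I ρ θ T c ψ) (hs : ∀ p, p ∈ θ.source)
    (a : Coord n) (ha : a ∈ θ.target) (x : X) :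
    dualCoord T c (ψ ∘ θ.symm) x a ∈ dualRange h τ I := by
  rw [← θ.right_inv ha, R.dualCoord_eq hs]
  exact mem_image_of_mem _ (mem_image_of_mem _ (R.mem _ (hs _) x))

theorem IsExpCoordRep.inverse_dualCoord (R : IsExpCoordRep h τ I ρ θ T c ψ) (hG : IsGauge h τ I)
    (hs : ∀ p, p ∈ θ.source) (p : M) (x : X) :
    hG.inverse (dualCoord T c (ψ ∘ θ.symm) x (θ p)) = τ (ρ p x) := by
  rw [R.dualCoord_eq hs, hG.inverse_deriv (mem_image_of_mem _ (R.mem _ (hs _) x))]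

theorem IsExpCoordRep.smooth_psi_hat (R : IsExpCoordRep h τ I ρ θ T c ψ)
    (hs : ∀ p, p ∈ θ.source) : ContDiffOn ℝ ∞ (ψ ∘ θ.symm) θ.target :=
  contDiffOn_comp_chart_symm R.chart fun p =>
    R.smooth_psi.contMDiffAt (θ.open_source.mem_nhds (hs p))

/-- The Legendre transform `u ↦ h'⁻¹(u) u - h(h'⁻¹(u))` of `h`. -/
def IsGauge.legendre (hG : IsGauge h τ I) (u : ℝ) : ℝ := hG.inverse u * u - h (hG.inverse u)

theorem IsGauge.smooth_h_inverse (hG : IsGauge h τ I) :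
    ContDiffOn ℝ ∞ (fun u => h (hG.inverse u)) (dualRange h τ I) :=
  hG.smooth_h.comp hG.smooth_inverse fun _ hu => hG.inverse_mem hu

theorem IsGauge.smooth_legendre (hG : IsGauge h τ I) :
    ContDiffOn ℝ ∞ hG.legendre (dualRange h τ I) :=
  (hG.smooth_inverse.mul contDiffOn_id).sub hG.smooth_h_inverse

/-- The two terms containing the derivative of the inverse cancel, because `h'` at `hG.inverse u` is
`u`. -/
theorem IsGauge.deriv_legendre (hG : IsGauge h τ I) {u : ℝ} (hu : u ∈ dualRange h τ I) :
    deriv hG.legendre u = hG.inverse u := by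
  have h1 := (hG.differentiableAt_inverse hu).hasDerivAt
  have h2 := (hG.hasDerivAt_h (hG.inverse_mem hu)).comp u h1
  rw [hG.deriv_inverse_eq hu] at h2
  have h3 : HasDerivAt hG.legendre
      (deriv hG.inverse u * u + hG.inverse u * 1 - u * deriv hG.inverse u) u :=
    (h1.mul (hasDerivAt_id u)).sub h2
  rw [h3.deriv]
  ring

/-- For a fixed point of the sample space the integrand of the divergence is a Bregman form. -/
theorem IsExpCoordRep.dHT_eq_bregmanForm (R : IsExpCoordRep h τ I ρ θ T c ψ) (hG : IsGauge h τ I)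
    (hs : ∀ p, p ∈ θ.source) (x : X) :
    (fun p q => dHT h τ (ρ p x) (ρ q x)) = bregmanForm θ
      (fun a => h (hG.inverse (dualCoord T c (ψ ∘ θ.symm) x a)) +
        hG.inverse (dualCoord T c (ψ ∘ θ.symm) x a) * c x)
      (fun a => hG.legendre (dualCoord T c (ψ ∘ θ.symm) x a))
      (fun a => hG.inverse (dualCoord T c (ψ ∘ θ.symm) x a)) (ψ ∘ θ.symm)
      (fun a => hG.inverse (dualCoord T c (ψ ∘ θ.symm) x a) • T x) := by
  funext p q
  simp only [bregmanForm, dHT, IsGauge.legendre, R.inverse_dualCoord hG hs, inner_smul_right]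
  rw [R.dualCoord_eq hs, R.eq q (hs q) x, Function.comp_apply, θ.left_inv (hs q)]
  ring

theorem IsExpCoordRep.continuous_comp_dualCoord {g : ℝ → ℝ}
    (R : IsExpCoordRep h τ I ρ θ T c ψ)
    (hs : ∀ p, p ∈ θ.source) (hg : ContinuousOn g (dualRange h τ I)) (p : M) :
    Continuous fun x => g (dualCoord T c (ψ ∘ θ.symm) x (θ p)) :=
  hg.comp_continuous (continuous_dualCoord R.continuous_T R.continuous_c _)
    fun x => R.dualCoord_mem hs _ (θ.map_source (hs p)) x

theorem IsExpCoordRep.continuous_deriv_inverse (R : IsExpCoordRep h τ I ρ θ T c ψ)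
    (hG : IsGauge h τ I) (hs : ∀ p, p ∈ θ.source) (p : M) :
    Continuous fun x => deriv hG.inverse (dualCoord T c (ψ ∘ θ.symm) x (θ p)) :=
  R.continuous_comp_dualCoord hs (hG.smooth_inverse.deriv_of_isOpen (m := ∞)
    hG.isOpen_dualRange (by simp)).continuousOn p

theorem IsExpCoordRep.neg_sStar_eq (R : IsExpCoordRep h τ I ρ θ T c ψ) (hG : IsGauge h τ I)
    (hs : ∀ p, p ∈ θ.source) (p : M) (x : X) :
    -sStar h τ (ρ p x) = hG.legendre (dualCoord T c (ψ ∘ θ.symm) x (θ p)) := by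
  simp only [sStar, IsGauge.legendre, R.inverse_dualCoord hG hs]
  rw [R.dualCoord_eq hs]
  ring

variable [MeasurableSpace X] {μ : Measure X}

/-- The integrals `∫ g(⟨a, T x⟩ - c x - ψ a) • w x dμ(x)` as functions of `a`. -/
def dualIntegral {F : Type} [NormedAddCommGroup F] [NormedSpace ℝ F] (μ : Measure X)
    (T : X → Coord n) (c : X → ℝ) (ψ : Coord n → ℝ) (g : ℝ → ℝ) (w : X → F) (a : Coord n) : F :=
  ∫ x, g (dualCoord T c ψ x a) • w x ∂μ

theorem IsExpCoordRep.intFun_tau (R : IsExpCoordRep h τ I ρ θ T c ψ) (hG : IsGauge h τ I)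
    (hs : ∀ p, p ∈ θ.source) (p : M) :
    intFun μ ρ τ p = dualIntegral μ T c (ψ ∘ θ.symm) hG.inverse (fun _ => (1 : ℝ)) (θ p) := by
  simp only [intFun, dualIntegral, R.inverse_dualCoord hG hs, smul_eq_mul, mul_one]

theorem IsExpCoordRep.neg_intFun_sStar (R : IsExpCoordRep h τ I ρ θ T c ψ) (hG : IsGauge h τ I)
    (hs : ∀ p, p ∈ θ.source) (p : M) :
    -intFun μ ρ (sStar h τ) p =
      dualIntegral μ T c (ψ ∘ θ.symm) hG.legendre (fun _ => (1 : ℝ)) (θ p) := by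
  simp only [intFun, dualIntegral, ← integral_neg, R.neg_sStar_eq hG hs, smul_eq_mul, mul_one]

variable [CompactSpace X] [BorelSpace X] [IsFiniteMeasureOnCompacts μ]
  {F : Type} [NormedAddCommGroup F] [NormedSpace ℝ F] {g : ℝ → ℝ} {w : X → F}

theorem IsExpCoordRep.contDiffOn_dualIntegral (R : IsExpCoordRep h τ I ρ θ T c ψ)
    (hG : IsGauge h τ I) (hs : ∀ p, p ∈ θ.source) (hg : ContDiffOn ℝ ∞ g (dualRange h τ I))
    (hw : Continuous w) :
    ContDiffOn ℝ ∞ (dualIntegral μ T c (ψ ∘ θ.symm) g w) θ.target :=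
  (dualIntegral_smooth θ.open_target hG.isOpen_dualRange R.continuous_T R.continuous_c
    (R.smooth_psi_hat hs) hg (R.dualCoord_mem hs) hw).1

theorem IsExpCoordRep.differentiableAt_dualIntegral (R : IsExpCoordRep h τ I ρ θ T c ψ)
    (hG : IsGauge h τ I) (hs : ∀ p, p ∈ θ.source) (hg : ContDiffOn ℝ ∞ g (dualRange h τ I))
    (hw : Continuous w) (p : M) :
    DifferentiableAt ℝ (dualIntegral μ T c (ψ ∘ θ.symm) g w) (θ p) :=
  ((R.contDiffOn_dualIntegral hG hs hg hw).contDiffAt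
    (θ.open_target.mem_nhds (θ.map_source (hs p)))).differentiableAt (by simp)

theorem IsExpCoordRep.fderiv_dualIntegral (R : IsExpCoordRep h τ I ρ θ T c ψ)
    (hG : IsGauge h τ I) (hs : ∀ p, p ∈ θ.source) (hg : ContDiffOn ℝ ∞ g (dualRange h τ I))
    (hw : Continuous w) (p : M) (v : Coord n) :
    fderiv ℝ (dualIntegral μ T c (ψ ∘ θ.symm) g w) (θ p) v =
      ∫ x, (deriv g (dualCoord T c (ψ ∘ θ.symm) x (θ p)) *
        dualCoordDeriv T (ψ ∘ θ.symm) x (θ p) v) • w x ∂μ :=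
  (dualIntegral_smooth θ.open_target hG.isOpen_dualRange R.continuous_T R.continuous_c
    (R.smooth_psi_hat hs) hg (R.dualCoord_mem hs) hw).2 _ (θ.map_source (hs p)) v

theorem IsExpCoordRep.integrable_tau (R : IsExpCoordRep h τ I ρ θ T c ψ) (hG : IsGauge h τ I)
    (hs : ∀ p, p ∈ θ.source) (p : M) : Integrable (fun x => τ (ρ p x)) μ := by
  have := R.continuous_comp_dualCoord hs hG.smooth_inverse.continuousOn p
  simp only [R.inverse_dualCoord hG hs] at this
  exact integrable_of_continuous_of_compactSpace this

theorem IsExpCoordRep.integrable_sStar (R : IsExpCoordRep h τ I ρ θ T c ψ) (hG : IsGauge h τ I)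
    (hs : ∀ p, p ∈ θ.source) (p : M) : Integrable (fun x => sStar h τ (ρ p x)) μ := by
  have := R.continuous_comp_dualCoord hs hG.smooth_legendre.continuousOn p
  simp only [← R.neg_sStar_eq hG hs] at this
  simpa using (integrable_of_continuous_of_compactSpace (μ := μ) this).neg

/-- The dual coordinates `∫ τ(p(x)) T(x) dμ(x)` as functions of the exponential ones. -/
abbrev expectation (hG : IsGauge h τ I) (μ : Measure X) (T : X → Coord n) (c : X → ℝ)
    (ψ : Coord n → ℝ) : Coord n → Coord n :=
  dualIntegral μ T c ψ hG.inverse T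

/-- The pointwise Bregman form is integrated term by term, each term being continuous on the compact
space `X`. Nonnegativity of the integrand identifies the extended integral with the Bochner
integral. -/
theorem IsExpCoordRep.divergence_eq (R : IsExpCoordRep h τ I ρ θ T c ψ) (hG : IsGauge h τ I)
    (hs : ∀ p, p ∈ θ.source) (p q : M) :
    divergence μ h τ ρ p q ≠ ⊤ ∧ (divergence μ h τ ρ p q).toReal = bregmanForm θ
      (fun a => dualIntegral μ T c (ψ ∘ θ.symm) (fun u => h (hG.inverse u)) (fun _ => (1 : ℝ)) a +
        dualIntegral μ T c (ψ ∘ θ.symm) hG.inverse c a)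
      (dualIntegral μ T c (ψ ∘ θ.symm) hG.legendre (fun _ => (1 : ℝ)))
      (dualIntegral μ T c (ψ ∘ θ.symm) hG.inverse (fun _ => (1 : ℝ))) (ψ ∘ θ.symm)
      (expectation hG μ T c (ψ ∘ θ.symm)) p q := by
  have hdx : ∀ x, dHT h τ (ρ p x) (ρ q x) = _ := fun x =>
    congrFun (congrFun (R.dHT_eq_bregmanForm hG hs x) p) q
  have hS := R.continuous_comp_dualCoord hs hG.smooth_inverse.continuousOn p
  have hint : ∀ {G : Type} [NormedAddCommGroup G] {f : X → G}, Continuous f → Integrable f μ :=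
    fun hf => integrable_of_continuous_of_compactSpace hf
  have i1 := hint (R.continuous_comp_dualCoord hs hG.smooth_h_inverse.continuousOn p)
  have i2 := hint (hS.mul R.continuous_c)
  have i3 := hint (R.continuous_comp_dualCoord hs hG.smooth_legendre.continuousOn q)
  have i4 := hint (hS.smul R.continuous_T)
  have i4' := i4.const_inner (𝕜 := ℝ) (θ q)
  have i5 := (hint hS).mul_const ((ψ ∘ θ.symm) (θ q))
  have hsum := (((i1.add i2).add i3).sub i4').add i5
  have hI : Integrable (fun x => dHT h τ (ρ p x) (ρ q x)) μ :=
    hsum.congr (ae_of_all _ fun x => (hdx x).symm)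
  have hnn : 0 ≤ᵐ[μ] fun x => dHT h τ (ρ p x) (ρ q x) :=
    ae_of_all _ fun x => hG.dHT_nonneg (R.mem p (hs p) x) (R.mem q (hs q) x)
  refine ⟨hI.lintegral_lt_top.ne, ?_⟩
  rw [divergence, ← integral_eq_lintegral_of_nonneg_ae hnn hI.aestronglyMeasurable]
  refine (integral_congr_ae (ae_of_all _ hdx)).trans ?_
  refine (integral_add_add_sub_add i1 i2 i3 i4' i5).trans ?_
  refine (congrArg₂ (_ + _ + _ - · + ·) (integral_inner i4 (θ q))
    (integral_mul_const _ _)).trans ?_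
  simp only [bregmanForm, expectation, dualIntegral, smul_eq_mul, mul_one, Pi.mul_apply,
    Pi.smul_apply']

theorem IsExpCoordRep.contMDiff_divergence (R : IsExpCoordRep h τ I ρ θ T c ψ)
    (hG : IsGauge h τ I) (hs : ∀ p, p ∈ θ.source) :
    ContMDiff ((𝓡 n).prod (𝓡 n)) 𝓘(ℝ, ℝ) ∞
      (fun z : M × M => (divergence μ h τ ρ z.1 z.2).toReal) := by
  simp only [fun p q => (R.divergence_eq (μ := μ) hG hs p q).2, bregmanForm]
  have hsm := contMDiff_globalChart R.chart hs
  have hcomp : ∀ {G : Type} [NormedAddCommGroup G] [NormedSpace ℝ G] {f : Coord n → G},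
      ContDiffOn ℝ ∞ f θ.target → ContMDiff (𝓡 n) 𝓘(ℝ, G) ∞ fun p => f (θ p) := fun hf p =>
    (hf.contDiffAt (θ.open_target.mem_nhds (θ.map_source (hs p)))).contMDiffAt.comp p (hsm p)
  have hI : ∀ {G : Type} [NormedAddCommGroup G] [NormedSpace ℝ G] {g : ℝ → ℝ} {w : X → G},
      ContDiffOn ℝ ∞ g (dualRange h τ I) → Continuous w → ContMDiff (𝓡 n) 𝓘(ℝ, G) ∞
        fun p => dualIntegral μ T c (ψ ∘ θ.symm) g w (θ p) := fun hg hw =>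
    hcomp (R.contDiffOn_dualIntegral hG hs hg hw)
  have hη := hI hG.smooth_inverse R.continuous_T
  have hin : ContMDiff ((𝓡 n).prod (𝓡 n)) 𝓘(ℝ, ℝ) ∞ fun z : M × M =>
      (inner ℝ (θ z.2) (expectation hG μ T c (ψ ∘ θ.symm) (θ z.1)) : ℝ) :=
    (contDiff_inner (𝕜 := ℝ) (E := Coord n)).contMDiff.comp
      ((hsm.comp contMDiff_snd).prodMk_space (hη.comp contMDiff_fst))
  refine ContMDiff.add (ContMDiff.sub (ContMDiff.add ?_ ?_) hin) (ContMDiff.mul ?_ ?_)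
  · exact ((hI hG.smooth_h_inverse continuous_const).add
      (hI hG.smooth_inverse R.continuous_c)).comp contMDiff_fst
  · exact (hI hG.smooth_legendre continuous_const).comp contMDiff_snd
  · exact (hI hG.smooth_inverse continuous_const).comp contMDiff_fst
  · exact (hcomp (R.smooth_psi_hat hs)).comp contMDiff_snd

end GlobalRepresentation

/-! ### Jacobian metrics, Hessians and uniqueness of the induced pair -/

section InducedPair

variable {n : ℕ} {M : Type*} [TopologicalSpace M] [ChartedSpace (Coord n) M]
  [IsManifold (𝓡 n) ∞ M] {θ : OpenPartialHomeomorph M (Coord n)}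

/-- The metric whose matrix in a global chart is a given Jacobian matrix. -/
def jacobianMetric (hθ : θ ∈ IsManifold.maximalAtlas (𝓡 n) ∞ M)
    (hs : ∀ p, p ∈ θ.source) (η : Coord n → Coord n) (hη : ContDiffOn ℝ ∞ η θ.target)
    (hsymm : ∀ p v w, inner ℝ w (fderiv ℝ η (θ p) v) = inner ℝ v (fderiv ℝ η (θ p) w))
    (hpos : ∀ p v, v ≠ 0 → 0 < inner ℝ v (fderiv ℝ η (θ p) v)) : Metric n M :=
  chartMetric hθ hs
    (fun a => (isBoundedBilinearMap_inner (𝕜 := ℝ) (E := Coord n)).toContinuousLinearMap.comp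
      (fderiv ℝ η a))
    (contDiffOn_const.clm_comp (hη.fderiv_of_isOpen θ.open_target (by simp)))
    (fun p v w => by simpa [real_inner_comm] using hsymm p v w)
    (fun p v hv => by simpa [real_inner_comm] using hpos p v hv)

theorem jacobianMetric_inner (hθ : θ ∈ IsManifold.maximalAtlas (𝓡 n) ∞ M)
    (hs : ∀ p, p ∈ θ.source) (η : Coord n → Coord n) (hη : ContDiffOn ℝ ∞ η θ.target)
    (hsymm : ∀ p v w, inner ℝ w (fderiv ℝ η (θ p) v) = inner ℝ v (fderiv ℝ η (θ p) w))
    (hpos : ∀ p v, v ≠ 0 → 0 < inner ℝ v (fderiv ℝ η (θ p) v)) (p : M)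
    (v w : TangentSpace (𝓡 n) p) :
    (jacobianMetric hθ hs η hη hsymm hpos).inner p v w =
      inner ℝ (mvfderiv (𝓡 n) θ p w) (fderiv ℝ η (θ p) (mvfderiv (𝓡 n) θ p v)) :=
  real_inner_comm (mvfderiv (𝓡 n) θ p w : Coord n)
    (fderiv ℝ η (θ p) (mvfderiv (𝓡 n) θ p v))

/-- In affine coordinates `∇ dΨ` is the ordinary Hessian. -/
theorem covHessian_flatConnection (hθ : θ ∈ IsManifold.maximalAtlas (𝓡 n) ∞ M)
    (hs : ∀ p, p ∈ θ.source) {η : Coord n → Coord n} (hη : ContDiffOn ℝ ∞ η θ.target)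
    {Ψ : Coord n → ℝ} (hΨ : ∀ p, DifferentiableAt ℝ Ψ (θ p))
    (hΨη : ∀ p v, fderiv ℝ Ψ (θ p) v = inner ℝ v (η (θ p))) (V W : VField n M) (p : M) :
    covHessian (flatConnection hθ hs) (fun q => Ψ (θ q)) V W p =
      inner ℝ (coordVec θ W p) (fderiv ℝ η (θ p) (coordVec θ V p)) := by
  have hηd : DifferentiableAt ℝ η (θ p) :=
    (hη.contDiffAt (θ.open_target.mem_nhds (θ.map_source (hs p)))).differentiableAt (by simp)
  have hW := differentiableAt_coordVec_comp_symm hθ hs W p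
  have e : dirDeriv W (fun q => Ψ (θ q)) =
      fun q => (fun a => inner ℝ ((coordVec θ W ∘ θ.symm) a) (η a)) (θ q) := by
    funext q
    rw [dirDeriv_comp_globalChart hθ hs W (hΨ q), hΨη]
    simp [θ.left_inv (hs q)]
  -- The product rule gives two terms; the one that differentiates the coordinates of `W` is exactly
  -- what the connection subtracts.
  rw [covHessian, e, dirDeriv_comp_globalChart hθ hs V (hW.inner ℝ hηd),
    fderiv_inner_apply ℝ hW hηd, fderiv_coordVec_comp_symm hθ hs,
    mvfderiv_eq_of_eventuallyEq_comp_chart hθ (hs p) (f := fun q => Ψ (θ q))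
      (Eventually.of_forall fun q => rfl) (hΨ p), ContinuousLinearMap.comp_apply,
    mvfderiv_flatConnection, hΨη]
  simp [θ.left_inv (hs p)]

/-- The metric and the connection induced by a two-point function are unique, hence so are their
potentials. -/
theorem IsInducedBy.isPotentialOn [T2Space M] [SecondCountableTopology M] {D : M → M → ℝ}
    {g g' : Metric n M} {cov cov' : Connection n M} (h : IsInducedBy D g cov)
    (h' : IsInducedBy D g' cov') {U : Set M} {Ψ : M → ℝ} (hΨ : IsPotentialOn g' cov' U Ψ) :
    IsPotentialOn g cov U Ψ := by
  have hg : ∀ p (v w : TangentSpace (𝓡 n) p), g.inner p v w = g'.inner p v w := by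
    intro p v w
    obtain ⟨V, rfl⟩ := exists_vField_apply_eq v
    obtain ⟨W, rfl⟩ := exists_vField_apply_eq w
    rw [h.1, h'.1]
  refine ⟨hΨ.1, fun V W p hp => ?_⟩
  have hc : cov W p (V p) = cov' W p (V p) := by
    -- The third-order formula determines the pairing of `∇_V W` with every tangent vector, and `g`
    -- is nondegenerate.
    have hd : ∀ w, g.inner p (cov W p (V p) - cov' W p (V p)) w = 0 := by
      intro w
      obtain ⟨Y, rfl⟩ := exists_vField_apply_eq w
      rw [map_sub, sub_apply, h.2, hg, h'.2, sub_self]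
    by_contra hne
    exact (g.pos p _ (sub_ne_zero.2 hne)).ne' (hd _)
  rw [hg, hΨ.2 V W p hp, covHessian, covHessian, hc]

end InducedPair

/-! ### The induced Hessian structure and its potential -/

section GlobalRepresentation

variable {n : ℕ} {X : Type*} [TopologicalSpace X]
  {M : Type*} [TopologicalSpace M] [ChartedSpace (Coord n) M]
  {h τ : ℝ → ℝ} {I : Set ℝ} {ρ : M → X → ℝ}
  {θ : OpenPartialHomeomorph M (Coord n)} {T : X → Coord n} {c : X → ℝ} {ψ : M → ℝ}

theorem IsExpCoordRep.hasFDerivAt_comp_dualCoord {g : ℝ → ℝ}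
    (R : IsExpCoordRep h τ I ρ θ T c ψ) (hG : IsGauge h τ I) (hs : ∀ p, p ∈ θ.source)
    (hg : ContDiffOn ℝ ∞ g (dualRange h τ I)) (x : X) (p : M) :
    HasFDerivAt (fun a => g (dualCoord T c (ψ ∘ θ.symm) x a))
      (deriv g (dualCoord T c (ψ ∘ θ.symm) x (θ p)) • dualCoordDeriv T (ψ ∘ θ.symm) x (θ p))
      (θ p) := by
  have hp := θ.map_source (hs p)
  have h1 : DifferentiableAt ℝ g (dualCoord T c (ψ ∘ θ.symm) x (θ p)) :=
    (hg.contDiffAt (hG.isOpen_dualRange.mem_nhds (R.dualCoord_mem hs _ hp x))).differentiableAt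
      (by simp)
  have h2 : DifferentiableAt ℝ (ψ ∘ θ.symm) (θ p) :=
    ((R.smooth_psi_hat hs).contDiffAt (θ.open_target.mem_nhds hp)).differentiableAt (by simp)
  exact h1.hasDerivAt.comp_hasFDerivAt (θ p) (hasFDerivAt_dualCoord h2)

/-- The derivative of `τ(p(x))` in exponential coordinates. -/
def score (hG : IsGauge h τ I) (T : X → Coord n) (c : X → ℝ) (ψ : Coord n → ℝ)
    (a v : Coord n) (x : X) : ℝ :=
  deriv hG.inverse (dualCoord T c ψ x a) * dualCoordDeriv T ψ x a v

theorem IsExpCoordRep.continuous_score (R : IsExpCoordRep h τ I ρ θ T c ψ) (hG : IsGauge h τ I)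
    (hs : ∀ p, p ∈ θ.source) (p : M) (v : Coord n) :
    Continuous (score hG T c (ψ ∘ θ.symm) (θ p) v) :=
  (R.continuous_deriv_inverse hG hs p).mul (continuous_dualCoordDeriv R.continuous_T _ v)

variable [MeasurableSpace X] {μ : Measure X}

/-- This is how constancy of `𝕀_τ` enters: every later use of that hypothesis passes through this
vanishing derivative. -/
theorem IsExpCoordRep.fderiv_intFun_tau_eq_zero (R : IsExpCoordRep h τ I ρ θ T c ψ)
    (hG : IsGauge h τ I) (hs : ∀ p, p ∈ θ.source) (hconst : ∃ C : ℝ, ∀ p : M, intFun μ ρ τ p = C)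
    (p : M) :
    fderiv ℝ (dualIntegral μ T c (ψ ∘ θ.symm) hG.inverse fun _ => (1 : ℝ)) (θ p) = 0 := by
  obtain ⟨C, hC⟩ := hconst
  have : dualIntegral μ T c (ψ ∘ θ.symm) hG.inverse (fun _ => (1 : ℝ)) =ᶠ[𝓝 (θ p)] fun _ => C := by
    filter_upwards [θ.open_target.mem_nhds (θ.map_source (hs p))] with a ha
    rw [← θ.right_inv ha, ← R.intFun_tau hG hs, hC]
  rw [this.fderiv_eq, fderiv_fun_const, Pi.zero_apply]

variable [CompactSpace X] [BorelSpace X] [IsFiniteMeasureOnCompacts μ]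

/-- Both induced formulas, differentiated under the integral sign, have integrands of this shape:
`m` and `k` are the coordinates of `W` and `dψ(W)` for the metric, and derivatives along `Z` of the
coordinates of `V` and of `dψ(V)` for the connection. -/
theorem IsExpCoordRep.integral_score (R : IsExpCoordRep h τ I ρ θ T c ψ) (hG : IsGauge h τ I)
    (hs : ∀ p, p ∈ θ.source) (p : M) (v m : Coord n) (k : ℝ) :
    Integrable (fun x => -inner ℝ m (score hG T c (ψ ∘ θ.symm) (θ p) v x • T x) +
      score hG T c (ψ ∘ θ.symm) (θ p) v x * k) μ ∧
    ∫ x, (-inner ℝ m (score hG T c (ψ ∘ θ.symm) (θ p) v x • T x) +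
      score hG T c (ψ ∘ θ.symm) (θ p) v x * k) ∂μ =
      -inner ℝ m (fderiv ℝ (expectation hG μ T c (ψ ∘ θ.symm)) (θ p) v) +
        fderiv ℝ (dualIntegral μ T c (ψ ∘ θ.symm) hG.inverse fun _ => (1 : ℝ)) (θ p) v * k := by
  have hc := R.continuous_score hG hs p v
  have i1 : Integrable (fun x => score hG T c (ψ ∘ θ.symm) (θ p) v x • T x) μ :=
    integrable_of_continuous_of_compactSpace (hc.smul R.continuous_T)
  have i2 := (integrable_of_continuous_of_compactSpace (μ := μ) hc).mul_const k
  refine ⟨(i1.const_inner (𝕜 := ℝ) m).neg.add i2, ?_⟩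
  rw [integral_add (f := fun x => -inner ℝ m (score hG T c (ψ ∘ θ.symm) (θ p) v x • T x))
    (i1.const_inner (𝕜 := ℝ) m).neg i2, integral_neg, integral_inner i1, integral_mul_const,
    R.fderiv_dualIntegral hG hs hG.smooth_inverse R.continuous_T,
    R.fderiv_dualIntegral hG hs hG.smooth_inverse continuous_const]
  simp only [score, smul_eq_mul, mul_one]

/-- The score has integral zero, so the constant `dψ(w)` may be subtracted from `⟨w, T⟩`. This
exhibits the Jacobian as a weighted Gram form, from which symmetry and positivity follow. -/
theorem IsExpCoordRep.inner_fderiv_expectation (R : IsExpCoordRep h τ I ρ θ T c ψ)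
    (hG : IsGauge h τ I) (hs : ∀ p, p ∈ θ.source) (hconst : ∃ C : ℝ, ∀ p : M, intFun μ ρ τ p = C)
    (p : M) (v w : Coord n) :
    inner ℝ w (fderiv ℝ (expectation hG μ T c (ψ ∘ θ.symm)) (θ p) v) =
      ∫ x, score hG T c (ψ ∘ θ.symm) (θ p) v x * dualCoordDeriv T (ψ ∘ θ.symm) x (θ p) w ∂μ := by
  have h1 := (R.integral_score (μ := μ) hG hs p v w (fderiv ℝ (ψ ∘ θ.symm) (θ p) w)).2
  rw [R.fderiv_intFun_tau_eq_zero hG hs hconst, zero_apply, zero_mul, add_zero] at h1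
  rw [← neg_eq_iff_eq_neg.2 h1, ← integral_neg]
  congr 1 with x
  rw [dualCoordDeriv_apply, inner_smul_right]
  ring

theorem IsExpCoordRep.inner_fderiv_expectation_comm (R : IsExpCoordRep h τ I ρ θ T c ψ)
    (hG : IsGauge h τ I) (hs : ∀ p, p ∈ θ.source) (hconst : ∃ C : ℝ, ∀ p : M, intFun μ ρ τ p = C)
    (p : M) (v w : Coord n) :
    inner ℝ w (fderiv ℝ (expectation hG μ T c (ψ ∘ θ.symm)) (θ p) v) =
      inner ℝ v (fderiv ℝ (expectation hG μ T c (ψ ∘ θ.symm)) (θ p) w) := by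
  rw [R.inner_fderiv_expectation hG hs hconst, R.inner_fderiv_expectation hG hs hconst]
  congr 1 with x
  rw [score, score]
  ring

/-- The derivative of the Legendre potential in exponential coordinates. -/
theorem IsExpCoordRep.hasFDerivAt_potential (R : IsExpCoordRep h τ I ρ θ T c ψ)
    (hG : IsGauge h τ I) (hs : ∀ p, p ∈ θ.source) (hconst : ∃ C : ℝ, ∀ p : M, intFun μ ρ τ p = C)
    (p : M) :
    HasFDerivAt (fun a => dualIntegral μ T c (ψ ∘ θ.symm) hG.legendre (fun _ => (1 : ℝ)) a +
      (ψ ∘ θ.symm) a * dualIntegral μ T c (ψ ∘ θ.symm) hG.inverse (fun _ => (1 : ℝ)) a)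
      (innerSL ℝ (expectation hG μ T c (ψ ∘ θ.symm) (θ p))) (θ p) := by
  have hp := θ.map_source (hs p)
  have hψ : DifferentiableAt ℝ (ψ ∘ θ.symm) (θ p) :=
    ((R.smooth_psi_hat hs).contDiffAt (θ.open_target.mem_nhds hp)).differentiableAt (by simp)
  have d1 := (R.differentiableAt_dualIntegral (μ := μ) hG hs hG.smooth_legendre
    (continuous_const (y := (1 : ℝ))) p).hasFDerivAt
  have d2 := (R.differentiableAt_dualIntegral (μ := μ) hG hs hG.smooth_inverse
    (continuous_const (y := (1 : ℝ))) p).hasFDerivAt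
  refine (d1.add (hψ.hasFDerivAt.mul d2)).congr_fderiv ?_
  ext v
  have hS := R.continuous_comp_dualCoord hs hG.smooth_inverse.continuousOn p
  have i1 : Integrable (fun x => hG.inverse (dualCoord T c (ψ ∘ θ.symm) x (θ p)) • T x) μ :=
    integrable_of_continuous_of_compactSpace (hS.smul R.continuous_T)
  have i2 := integrable_of_continuous_of_compactSpace (μ := μ) hS
  rw [R.fderiv_intFun_tau_eq_zero hG hs hconst]
  simp only [smul_zero, zero_add, add_apply, smul_apply, smul_eq_mul, innerSL_apply_apply]
  rw [R.fderiv_dualIntegral hG hs hG.smooth_legendre continuous_const, real_inner_comm,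
    expectation, dualIntegral, dualIntegral]
  -- The derivative of the Legendre integral is `⟨v, η⟩ - dψ(v) 𝕀_τ`, and the second term is
  -- cancelled by the derivative of `ψ 𝕀_τ`.
  refine Eq.trans (congrArg (· + _) ?_) (sub_add_cancel _ _)
  simp only [smul_eq_mul, mul_one]
  rw [← integral_mul_const, ← integral_inner i1 v,
    ← integral_sub (i1.const_inner (𝕜 := ℝ) v) (i2.mul_const _)]
  congr 1 with x
  rw [hG.deriv_legendre (R.dualCoord_mem hs _ hp x), dualCoordDeriv_apply]
  rw [inner_smul_right]
  ring

variable [IsManifold (𝓡 n) ∞ M] [T2Space M] [SecondCountableTopology M] [μ.IsOpenPosMeasure]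

/-- The integrand is a positive weight times the square of `⟨v, T⟩ - dψ(v)`. That function is
continuous and, by rigidity, not identically zero, so full support of `μ` gives a positive integral.
-/
theorem IsExpCoordRep.inner_fderiv_expectation_pos (R : IsExpCoordRep h τ I ρ θ T c ψ)
    (hG : IsGauge h τ I) (hM : IsExpFamily n μ h τ I ρ) (hs : ∀ p, p ∈ θ.source)
    (hconst : ∃ C : ℝ, ∀ p : M, intFun μ ρ τ p = C)
    (p : M) {v : Coord n} (hv : v ≠ 0) :
    0 < inner ℝ v (fderiv ℝ (expectation hG μ T c (ψ ∘ θ.symm)) (θ p) v) := by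
  have hpos : ∀ x, 0 < deriv hG.inverse (dualCoord T c (ψ ∘ θ.symm) x (θ p)) := fun x =>
    hG.deriv_inverse_pos (R.dualCoord_mem hs _ (θ.map_source (hs p)) x)
  obtain ⟨N, hN⟩ := hM.model
  obtain ⟨x, hx⟩ : ∃ x, dualCoordDeriv T (ψ ∘ θ.symm) x (θ p) v ≠ 0 := by
    by_contra! H
    refine hv (R.eq_zero_of_inner_const hG hM.density hN (hs p)
      (a := fderiv ℝ (ψ ∘ θ.symm) (θ p) v) fun x => ?_)
    rw [← sub_eq_zero, ← dualCoordDeriv_apply, H x]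
  rw [R.inner_fderiv_expectation hG hs hconst]
  refine Continuous.integral_pos_of_hasCompactSupport_nonneg_nonzero (x := x)
    ((R.continuous_score hG hs p v).mul (continuous_dualCoordDeriv R.continuous_T _ v))
    (HasCompactSupport.of_compactSpace _) (fun y => ?_) ?_
  · rw [score, mul_assoc]
    exact mul_nonneg (hpos y).le (mul_self_nonneg _)
  · exact mul_ne_zero (mul_ne_zero (hpos x).ne' hx) hx

/-- The metric induced by the divergence. -/
def IsExpCoordRep.metric (R : IsExpCoordRep h τ I ρ θ T c ψ) (hG : IsGauge h τ I)
    (hM : IsExpFamily n μ h τ I ρ) (hs : ∀ p, p ∈ θ.source)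
    (hconst : ∃ C : ℝ, ∀ p : M, intFun μ ρ τ p = C) : Metric n M :=
  jacobianMetric R.chart hs (expectation hG μ T c (ψ ∘ θ.symm))
    (R.contDiffOn_dualIntegral hG hs hG.smooth_inverse R.continuous_T)
    (R.inner_fderiv_expectation_comm hG hs hconst)
    (fun p _ hv => R.inner_fderiv_expectation_pos hG hM hs hconst p hv)

theorem IsExpCoordRep.metric_inner (R : IsExpCoordRep h τ I ρ θ T c ψ) (hG : IsGauge h τ I)
    (hM : IsExpFamily n μ h τ I ρ) (hs : ∀ p, p ∈ θ.source)
    (hconst : ∃ C : ℝ, ∀ p : M, intFun μ ρ τ p = C) (p : M) (v w : TangentSpace (𝓡 n) p) :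
    (R.metric hG hM hs hconst).inner p v w = inner ℝ (mvfderiv (𝓡 n) θ p w)
      (fderiv ℝ (expectation hG μ T c (ψ ∘ θ.symm)) (θ p) (mvfderiv (𝓡 n) θ p v)) :=
  jacobianMetric_inner _ _ _ _ _ _ _ _ _

theorem IsExpCoordRep.metric_inner_flatConnection (R : IsExpCoordRep h τ I ρ θ T c ψ)
    (hG : IsGauge h τ I) (hM : IsExpFamily n μ h τ I ρ) (hs : ∀ p, p ∈ θ.source)
    (hconst : ∃ C : ℝ, ∀ p : M, intFun μ ρ τ p = C) (V W Z : VField n M) (p : M) :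
    (R.metric hG hM hs hconst).inner p (flatConnection R.chart hs V p (Z p)) (W p) =
      inner ℝ (mvfderiv (𝓡 n) (coordVec θ V) p (Z p))
        (fderiv ℝ (expectation hG μ T c (ψ ∘ θ.symm)) (θ p) (coordVec θ W p)) := by
  rw [R.metric_inner, mvfderiv_flatConnection, R.inner_fderiv_expectation_comm hG hs hconst]
  rfl

theorem IsExpCoordRep.isInducedBy (R : IsExpCoordRep h τ I ρ θ T c ψ) (hG : IsGauge h τ I)
    (hM : IsExpFamily n μ h τ I ρ) (hs : ∀ p, p ∈ θ.source)
    (hconst : ∃ C : ℝ, ∀ p : M, intFun μ ρ τ p = C) :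
    IsInducedBy (fun p q => (divergence μ h τ ρ p q).toReal)
      (R.metric hG hM hs hconst) (flatConnection R.chart hs) := by
  have hψ := R.smooth_psi_hat hs
  have hψd : ∀ p, DifferentiableAt ℝ (ψ ∘ θ.symm) (θ p) := fun p =>
    (hψ.contDiffAt (θ.open_target.mem_nhds (θ.map_source (hs p)))).differentiableAt (by simp)
  have hη := R.differentiableAt_dualIntegral (μ := μ) hG hs hG.smooth_inverse R.continuous_T
  have hsd := R.differentiableAt_dualIntegral (μ := μ) hG hs hG.smooth_inverse
    (continuous_const (y := (1 : ℝ)))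
  have hD : (fun p q => (divergence μ h τ ρ p q).toReal) = _ :=
    funext fun p => funext fun q => (R.divergence_eq (μ := μ) hG hs p q).2
  rw [hD]
  refine ⟨fun V W p => ?_, fun V W Z p => ?_⟩
  · rw [fstDeriv_sndDeriv_bregmanForm R.chart hs
      (R.differentiableAt_dualIntegral hG hs hG.smooth_legendre continuous_const) hsd hψd hη,
      R.fderiv_intFun_tau_eq_zero hG hs hconst,
      zero_apply, zero_mul, add_zero, neg_neg, R.metric_inner]
    rfl
  · have hA := fun p => (R.differentiableAt_dualIntegral (μ := μ) hG hs hG.smooth_h_inverse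
      (continuous_const (y := (1 : ℝ))) p).fun_add
      (R.differentiableAt_dualIntegral (μ := μ) hG hs hG.smooth_inverse R.continuous_c p)
    rw [sndDeriv_sndDeriv_fstDeriv_bregmanForm R.chart hs hA hsd hψ hη,
      R.fderiv_intFun_tau_eq_zero hG hs hconst,
      zero_apply, zero_mul, add_zero, neg_neg, R.metric_inner_flatConnection]

/-- For a fixed sample point `τ(p(x))` need not be constant in `p`, so the integrand retains a term
in `ψ`; it disappears only after integration, where it carries the factor `d𝕀_τ = 0`. -/
theorem IsExpCoordRep.isInducedUnderIntegral (R : IsExpCoordRep h τ I ρ θ T c ψ)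
    (hG : IsGauge h τ I) (hM : IsExpFamily n μ h τ I ρ) (hs : ∀ p, p ∈ θ.source)
    (hconst : ∃ C : ℝ, ∀ p : M, intFun μ ρ τ p = C) :
    IsInducedUnderIntegral μ (fun x p q => dHT h τ (ρ p x) (ρ q x))
      (R.metric hG hM hs hconst) (flatConnection R.chart hs) := by
  have hψ := R.smooth_psi_hat hs
  have hψd : ∀ p, DifferentiableAt ℝ (ψ ∘ θ.symm) (θ p) := fun p =>
    (hψ.contDiffAt (θ.open_target.mem_nhds (θ.map_source (hs p)))).differentiableAt (by simp)
  have hS := fun x p => R.hasFDerivAt_comp_dualCoord hG hs hG.smooth_inverse x p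
  have hSd := fun x p => (hS x p).differentiableAt
  have hη := fun x p => (hSd x p).smul_const (T x)
  have hDs : ∀ x p v, fderiv ℝ (fun a => hG.inverse (dualCoord T c (ψ ∘ θ.symm) x a)) (θ p) v =
      score hG T c (ψ ∘ θ.symm) (θ p) v x := fun x p v => by
    rw [(hS x p).fderiv]; rfl
  have hDη : ∀ x p v,
      fderiv ℝ (fun a => hG.inverse (dualCoord T c (ψ ∘ θ.symm) x a) • T x) (θ p) v =
        score hG T c (ψ ∘ θ.symm) (θ p) v x • T x := fun x p v => by
    rw [((hS x p).smul_const (T x)).fderiv]; rfl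
  rw [show (fun x p q => dHT h τ (ρ p x) (ρ q x)) = _ from funext (R.dHT_eq_bregmanForm hG hs)]
  refine ⟨fun V W p => ?_, fun V W Z p => ?_⟩
  · have he := fun x =>
      fstDeriv_sndDeriv_bregmanForm (A := fun a => h (hG.inverse (dualCoord T c (ψ ∘ θ.symm) x a)) +
        hG.inverse (dualCoord T c (ψ ∘ θ.symm) x a) * c x) R.chart hs (fun p =>
        (R.hasFDerivAt_comp_dualCoord hG hs hG.smooth_legendre x p).differentiableAt) (hSd x) hψd
        (hη x) V W p p
    simp only [hDs, hDη] at he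
    obtain ⟨h1, h2⟩ := R.integral_score (μ := μ) hG hs p (coordVec θ V p) (coordVec θ W p)
      (fderiv ℝ (ψ ∘ θ.symm) (θ p) (coordVec θ W p))
    refine ⟨h1.congr (ae_of_all _ fun x => (he x).symm), ?_⟩
    rw [integral_congr_ae (ae_of_all _ he), h2, R.fderiv_intFun_tau_eq_zero hG hs hconst,
      zero_apply, zero_mul, add_zero, neg_neg, R.metric_inner]
    rfl
  · have hA := fun x p => ((R.hasFDerivAt_comp_dualCoord hG hs
      hG.smooth_h_inverse x p).differentiableAt.fun_add ((hSd x p).mul_const (c x)))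
    have he := fun x => sndDeriv_sndDeriv_fstDeriv_bregmanForm
      (B := fun a => hG.legendre (dualCoord T c (ψ ∘ θ.symm) x a)) R.chart hs (hA x) (hSd x) hψ
      (hη x) V W Z p p
    simp only [hDs, hDη] at he
    obtain ⟨h1, h2⟩ := R.integral_score (μ := μ) hG hs p (coordVec θ W p)
      (mvfderiv (𝓡 n) (coordVec θ V) p (Z p))
      (dirDeriv Z (fun q => fderiv ℝ (ψ ∘ θ.symm) (θ q) (coordVec θ V q)) p)
    refine ⟨h1.congr (ae_of_all _ fun x => (he x).symm), ?_⟩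
    rw [integral_congr_ae (ae_of_all _ he), h2, R.fderiv_intFun_tau_eq_zero hG hs hconst,
      zero_apply, zero_mul, add_zero, neg_neg, R.metric_inner_flatConnection]

theorem IsExpCoordRep.isPotentialOn_univ (R : IsExpCoordRep h τ I ρ θ T c ψ) (hG : IsGauge h τ I)
    (hM : IsExpFamily n μ h τ I ρ) (hs : ∀ p, p ∈ θ.source)
    (hconst : ∃ C : ℝ, ∀ p : M, intFun μ ρ τ p = C) :
    IsPotentialOn (R.metric hG hM hs hconst) (flatConnection R.chart hs) univ
      (fun p => -intFun μ ρ (sStar h τ) p + ψ p * intFun μ ρ τ p) := by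
  have e : (fun p => -intFun μ ρ (sStar h τ) p + ψ p * intFun μ ρ τ p) = fun p =>
      (fun a => dualIntegral μ T c (ψ ∘ θ.symm) hG.legendre (fun _ => (1 : ℝ)) a +
        (ψ ∘ θ.symm) a * dualIntegral μ T c (ψ ∘ θ.symm) hG.inverse (fun _ => (1 : ℝ)) a)
        (θ p) := by
    funext p
    simp [R.neg_intFun_sStar hG hs, R.intFun_tau hG hs, θ.left_inv (hs p)]
  have hΨ := R.hasFDerivAt_potential (μ := μ) hG hs hconst
  rw [e]
  refine ⟨?_, fun V W p _ => ?_⟩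
  · have h1 := (R.contDiffOn_dualIntegral (μ := μ) hG hs hG.smooth_legendre
      (continuous_const (y := (1 : ℝ)))).add ((R.smooth_psi_hat hs).mul
      (R.contDiffOn_dualIntegral (μ := μ) hG hs hG.smooth_inverse
        (continuous_const (y := (1 : ℝ)))))
    exact fun p _ => ((h1.contDiffAt (θ.open_target.mem_nhds
      (θ.map_source (hs p)))).contMDiffAt.comp p
      (contMDiff_globalChart R.chart hs p)).contMDiffWithinAt
  · rw [covHessian_flatConnection R.chart hs
      (R.contDiffOn_dualIntegral (μ := μ) hG hs hG.smooth_inverse R.continuous_T)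
      (fun p => (hΨ p).differentiableAt)
      (fun p v => by rw [(hΨ p).fderiv, innerSL_apply_apply, real_inner_comm]), R.metric_inner]
    rfl

end GlobalRepresentation

end DeformedExp

end

/-! ### The Hessian structure of an exponential family -/

theorem theorem1p1 {n : ℕ}
    {X : Type*} [TopologicalSpace X] [CompactSpace X] [MeasurableSpace X] [BorelSpace X]
    (μ : Measure X) [IsFiniteMeasureOnCompacts μ] [μ.IsOpenPosMeasure]
    {M : Type*} [TopologicalSpace M] [ChartedSpace (DeformedExp.Coord n) M]
    [IsManifold (𝓡 n) ∞ M] [T2Space M] [SecondCountableTopology M] [ConnectedSpace M]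
    (h τ : ℝ → ℝ) (I : Set ℝ) (hG : DeformedExp.IsGauge h τ I)
    (ρ : M → X → ℝ) (hM : DeformedExp.IsExpFamily n μ h τ I ρ)
    (hconst : ∃ C : ℝ, ∀ p : M, DeformedExp.intFun μ ρ τ p = C) :
    -- the divergence is finite and smooth
    (∀ p q : M, DeformedExp.divergence μ h τ ρ p q ≠ ⊤) ∧
    ContMDiff ((𝓡 n).prod (𝓡 n)) 𝓘(ℝ, ℝ) ∞
      (fun z : M × M => (DeformedExp.divergence μ h τ ρ z.1 z.2).toReal) ∧
    -- the integrals in the potential exist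
    (∀ p : M, Integrable (fun x => τ (ρ p x)) μ ∧
      Integrable (fun x => DeformedExp.sStar h τ (ρ p x)) μ) ∧
    ∃ (g : DeformedExp.Metric n M) (cov : DeformedExp.Connection n M),
      DeformedExp.IsInducedBy
        (fun p q => (DeformedExp.divergence μ h τ ρ p q).toReal) g cov ∧
      DeformedExp.IsInducedUnderIntegral μ
        (fun x p q => DeformedExp.dHT h τ (ρ p x) (ρ q x)) g cov ∧
      DeformedExp.IsHessianStructure g cov ∧
      (∃ ψ : M → ℝ, DeformedExp.IsGlobalNormalization n h τ I ρ ψ) ∧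
      ∀ ψ : M → ℝ, DeformedExp.IsGlobalNormalization n h τ I ρ ψ →
        DeformedExp.IsPotentialOn g cov Set.univ (fun p =>
          -DeformedExp.intFun μ ρ (DeformedExp.sStar h τ) p
            + ψ p * DeformedExp.intFun μ ρ τ p) := by
  obtain ⟨θ, T, c, ψ, hθ, R⟩ := hM.exists_global_rep hG
  have hs : ∀ p, p ∈ θ.source := Set.eq_univ_iff_forall.1 hθ
  have hind := R.isInducedBy hG hM hs hconst
  refine ⟨fun p q => (R.divergence_eq hG hs p q).1, R.contMDiff_divergence hG hs,
    fun p => ⟨R.integrable_tau hG hs p, R.integrable_sStar hG hs p⟩,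
    R.metric hG hM hs hconst, DeformedExp.flatConnection R.chart hs, hind,
    R.isInducedUnderIntegral hG hM hs hconst,
    ⟨DeformedExp.contMDiff_flatConnection R.chart hs, DeformedExp.isFlat_flatConnection R.chart hs,
      fun p => ⟨Set.univ, isOpen_univ, Set.mem_univ p, _, R.isPotentialOn_univ hG hM hs hconst⟩⟩,
    ⟨ψ, θ, T, c, hθ, R⟩, fun ψ' hψ' => ?_⟩
  obtain ⟨θ', T', c', hθ', R'⟩ := hψ'
  have hs' : ∀ p, p ∈ θ'.source := Set.eq_univ_iff_forall.1 hθ'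
  -- The representation belonging to `ψ'` constructs its own metric and connection. Both pairs are
  -- induced by the same divergence, so the potential property transfers.
  exact hind.isPotentialOn (R'.isInducedBy hG hM hs' hconst)
    (R'.isPotentialOn_univ hG hM hs' hconst)
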